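/- Let $q$ be a prime power, let $n \ge 20$ be an integer and let $S \subseteq \mathbb{F}_q^n$. Let $\tau > 1$ and $\delta \in (0, 1/10)$ be real numbers such that $$q \;\ge\; \max\left( n\,\frac{1+\tau}{(\tau-\sqrt{\tau})^2\,\delta^2},\; n \right).$$ Suppose that $q^r < |S| \le q^{r+1}$ for some integer $r$ with $4 \le r \le n-1$, and let $t = r-3$. Let $U_S$ denote a uniformly distributed random element of $S$. Then at least a $(1-\delta)$-fraction of all surjective $\mathbb{F}_q$-linear maps $L : \mathbb{F}_q^n \to \mathbb{F}_q^t$ are such that the distribution of $L(U_S)$ is $\tau/q^t$-close to the uniform distribution on $\mathbb{F}_q^t$ in the $\ell_\infty$ norm, that is, $$\left| \Pr[L(U_S) = y] - q^{-t} \right| \le \tau\, q^{-t} \qquad \text{for all } y \in \mathbb{F}_q^t.$$ -/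

import Mathlib

/-- Two probability distributions `p`, `p'` on a type are `ε`-close in the `ℓ_∞` norm if
`|p(y) - p'(y)| ≤ ε` for every outcome `y`. -/
def LInftyClose {α : Type*} (p p' : PMF α) (ε : ℝ) : Prop :=
  ∀ y : α, |(p y).toReal - (p' y).toReal| ≤ ε

/-- The distribution of `L(U_S)`, where `U_S` is uniformly distributed on the
nonempty finite set `S`. -/
noncomputable def imageOfUniform {α β : Type*} (L : α → β) (S : Finset α) (hS : S.Nonempty) :
    PMF β :=
  (PMF.uniformOfFinset S hS).map L

/-- The set of all surjective linear maps `F^n → F^t`. -/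
def surjLinearMaps (F : Type*) [Field F] (n t : ℕ) :
    Set ((Fin n → F) →ₗ[F] (Fin t → F)) :=
  {L | Function.Surjective L}

/-- At least a `c`-fraction of the elements of the (finite) set `A` satisfy `P`. -/
def AtLeastFraction {α : Type*} (c : ℝ) (A : Set α) (P : α → Prop) : Prop :=
  c * (A.ncard : ℝ) ≤ ({a ∈ A | P a}.ncard : ℝ)

/-! Since τ > 1, a fibre cannot be too small, so only fibres larger than 1 + τ times the average
matter. Call L bad if it has one, and suppose that more than a fraction δ of the surjective maps is
bad. The contradiction comes from a weighted Kakeya estimate in F^N with N = t + 2, where S has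
average fibre size μ = |S| / q^N > q.

Fix a pair v of vectors of F^N, split F^N as F^t × F^2 with v in the second factor, and write a
random map as M = (L, Q). If L is bad, its large fibre has at least h₀ q^2 points, h₀ = (1 + τ) μ.
By pairwise independence a random Q usually spreads it so evenly over F^2 that the fibre sizes of M,
truncated at C ≈ 3h₀/4, sum to at least (1 - ε) C q^2 on a translate of a plane containing v. So
every v is heavy for a fraction 0.79 δ of all M (`card_mul_card_le_card_filter_heavyDirection`), and
averaging gives j maps making all but a fraction (1 - 0.79 δ)^j of the pairs heavy (`exists_cover`).
The sum of their fibre counts, truncated at C, is a weight of total at most j |S|.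

Such a weight cannot be small (`weighted_kakeya_bound`). Interpolate a nonzero P of degree at most d
vanishing to order m w(y) at every y. On a heavy plane, Schwartz-Zippel with multiplicities
(`sum_multiplicity_le`) kills the low-order Hasse derivatives of P, hence those of its leading form
on the parallel plane through 0, even over extension fields. Encode v as the point v.1 + T v.2 with
T outside F. The leading form then vanishes to high order on a fraction ρ of a grid of side q^2, and
Schwartz-Zippel on that grid costs only a factor 1 + 1/(ρ q) per coordinate. The resulting lower
bound on j |S| / (C q^N) contradicts a suitable choice of j (`exists_number_of_maps`). -/

/-! ### Order of vanishing and translation of variables -/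

open MvPolynomial in
/-- All coefficients of `P` of degree less than `m` vanish. -/
def OrderGE {σ R : Type*} [CommSemiring R] (m : ℕ) (P : MvPolynomial σ R) : Prop :=
  ∀ s : σ →₀ ℕ, s.degree < m → coeff s P = 0

/-- The polynomial `P(X + a)`. -/
noncomputable def shiftVars {σ R : Type*} [CommSemiring R] (a : σ → R) :
    MvPolynomial σ R →ₐ[R] MvPolynomial σ R :=
  MvPolynomial.aeval (fun i => MvPolynomial.X i + MvPolynomial.C (a i))

/-- `P` vanishes at the point `a` with multiplicity at least `m`. -/
def VanishesAt {σ R : Type*} [CommSemiring R] (a : σ → R) (m : ℕ) (P : MvPolynomial σ R) : Prop :=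
  OrderGE m (shiftVars a P)

theorem shiftVars_X {σ R : Type*} [CommSemiring R] (a : σ → R) (i : σ) :
    shiftVars a (MvPolynomial.X i) = MvPolynomial.X i + MvPolynomial.C (a i) := by
  simp [shiftVars]

theorem shiftVars_C {σ R : Type*} [CommSemiring R] (a : σ → R) (r : R) :
    shiftVars a (MvPolynomial.C r) = MvPolynomial.C r := by
  simp [shiftVars]

theorem shiftVars_neg_shiftVars {σ R : Type*} [CommRing R] (a : σ → R) (P : MvPolynomial σ R) :
    shiftVars (-a) (shiftVars a P) = P := by
  have : (shiftVars (-a)).comp (shiftVars a) = AlgHom.id R _ := by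
    ext i : 1
    simp [shiftVars_X]
  simpa using DFunLike.congr_fun this P

theorem shiftVars_ne_zero {σ R : Type*} [CommRing R] (a : σ → R) {P : MvPolynomial σ R}
    (hP : P ≠ 0) : shiftVars a P ≠ 0 := fun h => hP <| by
  rw [← shiftVars_neg_shiftVars a P, h, map_zero]

/-- A translation acts separately on the first variable, as a Taylor shift, and on the coefficients.
This is what allows induction on the number of variables. -/
theorem finSuccEquiv_shiftVars {R : Type*} [CommRing R] {n : ℕ} (a₀ : R) (a : Fin n → R)
    (P : MvPolynomial (Fin (n + 1)) R) :
    MvPolynomial.finSuccEquiv R n (shiftVars (Fin.cons a₀ a) P) =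
      (Polynomial.taylor (MvPolynomial.C a₀) (MvPolynomial.finSuccEquiv R n P)).map
        (shiftVars a).toRingHom := by
  have hC : ∀ r : R, MvPolynomial.finSuccEquiv R n (MvPolynomial.C r) =
      Polynomial.C (MvPolynomial.C r) := fun r => by simp [MvPolynomial.finSuccEquiv_apply]
  have hX : ∀ i, MvPolynomial.finSuccEquiv R n (shiftVars (Fin.cons a₀ a) (MvPolynomial.X i)) =
      (Polynomial.taylor (MvPolynomial.C a₀) (MvPolynomial.finSuccEquiv R n
        (MvPolynomial.X i))).map (shiftVars a).toRingHom := by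
    intro i
    cases i using Fin.cases with
    | zero =>
      rw [shiftVars_X, map_add, hC, MvPolynomial.finSuccEquiv_X_zero, Polynomial.taylor_X,
        Polynomial.map_add, Polynomial.map_X, Polynomial.map_C, Fin.cons_zero]
      exact congrArg (fun z => Polynomial.X + Polynomial.C z) (shiftVars_C a a₀).symm
    | succ j =>
      rw [shiftVars_X, map_add, hC, MvPolynomial.finSuccEquiv_X_succ, Polynomial.taylor_C,
        Polynomial.map_C, Fin.cons_succ, ← Polynomial.C_add]
      exact congrArg Polynomial.C (shiftVars_X a j).symm
  induction P using MvPolynomial.induction_on with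
  | C r => simp [hC]
  | add p q hp hq => simp [hp, hq]
  | mul_X p i hp =>
    rw [map_mul, map_mul, map_mul, hp, Polynomial.taylor_mul, Polynomial.map_mul, hX]

theorem degree_finsupp_cons {n : ℕ} (k : ℕ) (s : Fin n →₀ ℕ) :
    (s.cons k).degree = k + s.degree := by
  simp [Finsupp.degree_eq_sum, Fin.sum_univ_succ]

/-! ### The Schwartz-Zippel lemma with multiplicities -/

/-- Apply a linear functional to every coefficient of a polynomial. -/
noncomputable def mapCoeff {F A : Type*} [CommRing F] [CommRing A] [Algebra F A] (l : A →ₗ[F] F)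
    (Q : Polynomial A) : Polynomial F :=
  ∑ j ∈ Finset.range (Q.natDegree + 1), Polynomial.monomial j (l (Q.coeff j))

theorem coeff_mapCoeff {F A : Type*} [CommRing F] [CommRing A] [Algebra F A] (l : A →ₗ[F] F)
    (Q : Polynomial A) (k : ℕ) : (mapCoeff l Q).coeff k = l (Q.coeff k) := by
  rw [mapCoeff, Polynomial.finsetSum_coeff]
  simp only [Polynomial.coeff_monomial]
  rw [Finset.sum_ite_eq' (Finset.range (Q.natDegree + 1)) k]
  split_ifs with h
  · rfl
  · rw [Polynomial.coeff_eq_zero_of_natDegree_lt, map_zero]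
    simpa using h

/-- Because `a` is a scalar and `l` is `F`-linear, applying `l` commutes with Taylor expansion at
`a`; the hypothesis removes the first `m` terms of the expansion. -/
theorem pow_dvd_mapCoeff {F A : Type*} [CommRing F] [CommRing A] [Algebra F A] (l : A →ₗ[F] F)
    (Q : Polynomial A) (a : F) (m : ℕ)
    (h : ∀ k < m, l ((Polynomial.taylor (algebraMap F A a) Q).coeff k) = 0) :
    (Polynomial.X - Polynomial.C a) ^ m ∣ mapCoeff l Q := by
  set T := Polynomial.taylor (algebraMap F A a) Q with hT
  have key : mapCoeff l Q = ∑ k ∈ Finset.range (T.natDegree + 1),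
      Polynomial.C (l (T.coeff k)) * (Polynomial.X - Polynomial.C a) ^ k := by
    have hQ := Polynomial.sum_taylor_eq Q (algebraMap F A a)
    rw [← hT, Polynomial.sum_over_range _ (by simp)] at hQ
    ext j
    rw [coeff_mapCoeff, ← hQ, Polynomial.finsetSum_coeff, Polynomial.finsetSum_coeff, map_sum]
    refine Finset.sum_congr rfl fun k _ => ?_
    have : (Polynomial.X - Polynomial.C (algebraMap F A a)) ^ k =
        ((Polynomial.X - Polynomial.C a) ^ k).map (algebraMap F A) := by simp
    rw [this, Polynomial.coeff_C_mul, Polynomial.coeff_C_mul, Polynomial.coeff_map, mul_comm,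
      ← Algebra.smul_def, map_smul, smul_eq_mul, mul_comm]
  rw [key]
  refine Finset.dvd_sum fun k _ => ?_
  rcases lt_or_ge k m with hk | hk
  · simp [h k hk]
  · exact (pow_dvd_pow _ hk).mul_left _

theorem exists_least_coeff {σ R : Type*} [CommSemiring R] {P : MvPolynomial σ R} (hP : P ≠ 0) :
    ∃ s : σ →₀ ℕ, P.coeff s ≠ 0 ∧ OrderGE s.degree P := by
  classical
  have hne : P.support.Nonempty := by
    rw [Finset.nonempty_iff_ne_empty]; simpa using hP
  obtain ⟨s, hs, hmin⟩ := Finset.exists_min_image P.support Finsupp.degree hne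
  refine ⟨s, by simpa using hs, fun u hu => ?_⟩
  by_contra h
  exact absurd (hmin u (by simpa using h)) (by omega)

theorem sum_le_natDegree_of_pow_dvd {F : Type*} [Field F] {R : Polynomial F} (hR : R ≠ 0)
    (G : Finset F) (M : F → ℕ) (h : ∀ a ∈ G, (Polynomial.X - Polynomial.C a) ^ M a ∣ R) :
    ∑ a ∈ G, M a ≤ R.natDegree := by
  classical
  calc ∑ a ∈ G, M a ≤ ∑ a ∈ G, R.roots.count a := Finset.sum_le_sum fun a ha => by
        rw [Polynomial.count_roots]; exact (Polynomial.le_rootMultiplicity_iff hR).2 (h a ha)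
    _ ≤ ∑ a ∈ G ∪ R.roots.toFinset, R.roots.count a :=
        Finset.sum_le_sum_of_subset Finset.subset_union_left
    _ = R.roots.card := Multiset.sum_count_eq_card fun a ha =>
        Finset.mem_union_right _ (Multiset.mem_toFinset.2 ha)
    _ ≤ R.natDegree := Polynomial.card_roots' R

/-- The Schwartz-Zippel lemma with multiplicities. -/
theorem sum_multiplicity_le {F : Type*} [Field F] (G : Finset F) : ∀ (n : ℕ)
    (P : MvPolynomial (Fin n) F), P ≠ 0 → ∀ M : (Fin n → F) → ℕ,
    (∀ a ∈ Fintype.piFinset (fun _ => G), VanishesAt a (M a) P) →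
    G.card * ∑ a ∈ Fintype.piFinset (fun _ : Fin n => G), M a ≤ P.totalDegree * G.card ^ n := by
  classical
  intro n
  induction n with
  | zero =>
    intro P hP M hM
    have h0 : ∀ a ∈ Fintype.piFinset (fun _ : Fin 0 => G), M a = 0 := by
      intro a ha
      by_contra hne
      refine shiftVars_ne_zero a hP ?_
      ext s
      rw [MvPolynomial.coeff_zero]
      refine hM a ha s ?_
      rw [Subsingleton.elim s 0]
      simpa using Nat.pos_of_ne_zero hne
    rw [Finset.sum_eq_zero h0]
    simp
  | succ n ih =>
    intro P hP M hM
    set Q := MvPolynomial.finSuccEquiv F n P with hQ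
    have hQ0 : Q ≠ 0 := by simpa [hQ] using hP
    set t := Q.natDegree with ht
    have hlead : Q.leadingCoeff ≠ 0 := by simpa using hQ0
    have hdeg : Q.leadingCoeff.totalDegree + t ≤ P.totalDegree :=
      MvPolynomial.totalDegree_coeff_finSuccEquiv_add_le P t hlead
    -- The degree of `i a` is the exact order of vanishing of the leading coefficient at `a`.
    choose i hi hiM using fun a : Fin n → F => exists_least_coeff (shiftVars_ne_zero a hlead)
    have hIH := ih Q.leadingCoeff hlead (fun a => (i a).degree) (fun a _ => hiM a)
    -- On the line above `a`, extracting the coefficient `i a` after translation by `a` gives a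
    -- nonzero univariate polynomial of degree at most `t`. At each `x` it keeps all but `(i
    -- a).degree` of the multiplicity.
    have hfib : ∀ a ∈ Fintype.piFinset (fun _ : Fin n => G),
        ∑ x ∈ G, M (Fin.cons x a) ≤ G.card * (i a).degree + t := by
      intro a ha
      let l : MvPolynomial (Fin n) F →ₗ[F] F :=
        (MvPolynomial.lcoeff F (i a)).comp (shiftVars a).toLinearMap
      have hl : ∀ p, l p = (shiftVars a p).coeff (i a) := fun p => rfl
      have hR0 : mapCoeff l Q ≠ 0 := by
        intro h0
        have := coeff_mapCoeff l Q t
        rw [h0, Polynomial.coeff_zero, hl] at this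
        exact hi a this.symm
      have hRd : (mapCoeff l Q).natDegree ≤ t := by
        rw [Polynomial.natDegree_le_iff_coeff_eq_zero]
        intro k hk
        rw [coeff_mapCoeff, Polynomial.coeff_eq_zero_of_natDegree_lt hk, map_zero]
      have hdiv : ∀ x ∈ G, (Polynomial.X - Polynomial.C x) ^ (M (Fin.cons x a) - (i a).degree) ∣
          mapCoeff l Q := by
        intro x hx
        refine pow_dvd_mapCoeff l Q x _ fun k hk => ?_
        have hmem : (Fin.cons x a : Fin (n + 1) → F) ∈ Fintype.piFinset (fun _ => G) := by
          rw [Fintype.mem_piFinset] at ha ⊢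
          exact fun j => Fin.cases (by simpa using hx) (fun j => by simpa using ha j) j
        have h1 := hM _ hmem ((i a).cons k) (by rw [degree_finsupp_cons]; omega)
        rw [← MvPolynomial.finSuccEquiv_coeff_coeff, finSuccEquiv_shiftVars,
          Polynomial.coeff_map] at h1
        exact h1
      have h2 := sum_le_natDegree_of_pow_dvd hR0 G _ hdiv
      calc ∑ x ∈ G, M (Fin.cons x a)
          ≤ ∑ x ∈ G, ((i a).degree + (M (Fin.cons x a) - (i a).degree)) :=
            Finset.sum_le_sum fun x _ => by omega
        _ = G.card * (i a).degree + ∑ x ∈ G, (M (Fin.cons x a) - (i a).degree) := by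
            rw [Finset.sum_add_distrib, Finset.sum_const, smul_eq_mul]
        _ ≤ _ := by omega
    have hsum : ∑ a ∈ Fintype.piFinset (fun _ : Fin (n + 1) => G), M a =
        ∑ a ∈ Fintype.piFinset (fun _ : Fin n => G), ∑ x ∈ G, M (Fin.cons x a) := by
      rw [← Finset.sum_product']
      refine Finset.sum_bij' (fun a _ => (Fin.tail a, a 0)) (fun p _ => Fin.cons p.2 p.1)
        ?_ ?_ ?_ ?_ ?_
      · intro a ha
        rw [Fintype.mem_piFinset] at ha
        simp only [Finset.mem_product, Fintype.mem_piFinset]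
        exact ⟨fun j => ha _, ha 0⟩
      · rintro ⟨a, x⟩ h
        simp only [Finset.mem_product, Fintype.mem_piFinset] at h ⊢
        exact fun j => Fin.cases (by simpa using h.2) (fun j => by simpa using h.1 j) j
      · intro a _; simp
      · intro p _; simp
      · intro a _; simp
    have hcard : (Fintype.piFinset (fun _ : Fin n => G)).card = G.card ^ n := by simp
    calc G.card * ∑ a ∈ Fintype.piFinset (fun _ : Fin (n + 1) => G), M a
        ≤ G.card * ∑ a ∈ Fintype.piFinset (fun _ : Fin n => G), (G.card * (i a).degree + t) := by
          rw [hsum]; exact Nat.mul_le_mul_left _ (Finset.sum_le_sum hfib)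
      _ = G.card * (G.card * ∑ a ∈ Fintype.piFinset (fun _ : Fin n => G), (i a).degree)
          + t * G.card ^ (n + 1) := by
          rw [Finset.sum_add_distrib, ← Finset.mul_sum, Finset.sum_const, hcard, smul_eq_mul]
          ring
      _ ≤ G.card * (Q.leadingCoeff.totalDegree * G.card ^ n) + t * G.card ^ (n + 1) := by
          gcongr
      _ = (Q.leadingCoeff.totalDegree + t) * G.card ^ (n + 1) := by ring
      _ ≤ _ := Nat.mul_le_mul_right _ hdeg

/-! ### Bidegrees in substitutions into an iterated polynomial ring -/

/-- Every bidegree `(i, s)` occurring in the iterated polynomial `Q` has total degree in `D`. -/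
def SupportedIn {σ τ R : Type*} [CommSemiring R] (D : Set ℕ)
    (Q : MvPolynomial τ (MvPolynomial σ R)) : Prop :=
  ∀ i s, (Q.coeff i).coeff s ≠ 0 → i.degree + s.degree ∈ D

section SupportedIn

variable {σ τ υ R : Type*} [CommRing R] {D D' : Set ℕ} {P Q : MvPolynomial τ (MvPolynomial σ R)}

theorem SupportedIn.mono (h : SupportedIn D Q) (hD : D ⊆ D') : SupportedIn D' Q :=
  fun i s hs => hD (h i s hs)

theorem SupportedIn.add (hP : SupportedIn D P) (hQ : SupportedIn D Q) : SupportedIn D (P + Q) := by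
  intro i s h
  by_cases h' : (P.coeff i).coeff s = 0
  · exact hQ i s (by simpa [h'] using h)
  · exact hP i s h'

theorem SupportedIn.sum {ι : Type*} (t : Finset ι) (f : ι → MvPolynomial τ (MvPolynomial σ R))
    (h : ∀ j ∈ t, SupportedIn D (f j)) : SupportedIn D (∑ j ∈ t, f j) := by
  classical
  induction t using Finset.induction_on with
  | empty => intro i s hs; simp at hs
  | insert a t ha ih =>
    rw [Finset.sum_insert ha]
    exact (h a (Finset.mem_insert_self _ _)).add
      (ih fun j hj => h j (Finset.mem_insert_of_mem hj))

theorem SupportedIn.mul {D'' : Set ℕ} (hP : SupportedIn D P) (hQ : SupportedIn D' Q)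
    (hD : ∀ x ∈ D, ∀ y ∈ D', x + y ∈ D'') : SupportedIn D'' (P * Q) := by
  classical
  intro i s h
  rw [MvPolynomial.coeff_mul, MvPolynomial.coeff_sum] at h
  obtain ⟨⟨i₁, i₂⟩, hi, h⟩ := Finset.exists_ne_zero_of_sum_ne_zero h
  rw [MvPolynomial.coeff_mul] at h
  obtain ⟨⟨s₁, s₂⟩, hs, h⟩ := Finset.exists_ne_zero_of_sum_ne_zero h
  rw [Finset.HasAntidiagonal.mem_antidiagonal] at hi hs
  have h1 := hP i₁ s₁ (left_ne_zero_of_mul h)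
  have h2 := hQ i₂ s₂ (right_ne_zero_of_mul h)
  have h3 := hD _ h1 _ h2
  dsimp only at hi hs
  rw [← hi, ← hs, map_add, map_add]
  convert h3 using 1
  ring

theorem supportedIn_algebraMap (r : R) (hD : 0 ∈ D) :
    SupportedIn D (algebraMap R (MvPolynomial τ (MvPolynomial σ R)) r) := by
  classical
  intro i s h
  have : algebraMap R (MvPolynomial τ (MvPolynomial σ R)) r =
    MvPolynomial.C (MvPolynomial.C r) := rfl
  rw [this, MvPolynomial.coeff_C] at h
  split_ifs at h with hi
  · rw [MvPolynomial.coeff_C] at h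
    split_ifs at h with hs
    · subst hi; subst hs; simpa using hD
    · exact absurd rfl h
  · simp at h

/-- Stated for any additive family of degree sets, so that upper bounds (`Set.Iic`), lower bounds
(`Set.Ici`) and exact degrees (singletons) share one proof. -/
theorem supportedIn_prod_pow {V : ℕ → Set ℕ} (h0 : 0 ∈ V 0)
    (hV : ∀ a b, ∀ x ∈ V a, ∀ y ∈ V b, x + y ∈ V (a + b))
    {φ : υ → MvPolynomial τ (MvPolynomial σ R)} (hφ : ∀ j, SupportedIn (V 1) (φ j))
    (u : υ →₀ ℕ) : SupportedIn (V u.degree) (u.prod fun j n => φ j ^ n) := by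
  classical
  induction u using Finsupp.induction_linear with
  | zero =>
    have := supportedIn_algebraMap (σ := σ) (τ := τ) (1 : R) h0
    simpa using this
  | add u v hu hv =>
    rw [Finsupp.prod_add_index' (by simp) (fun _ _ _ => pow_add _ _ _), map_add]
    exact hu.mul hv (hV _ _)
  | single j n =>
    rw [Finsupp.prod_single_index (by simp), Finsupp.degree_single]
    induction n with
    | zero =>
      have := supportedIn_algebraMap (σ := σ) (τ := τ) (1 : R) h0
      simpa using this
    | succ n ih =>
      rw [pow_succ]
      exact ih.mul (hφ j) (hV _ _)

/-- Telescoping: changing the factors only in degree below 1 changes a product only below its top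
degree. -/
theorem supportedIn_prod_pow_sub {φ ψ : υ → MvPolynomial τ (MvPolynomial σ R)}
    (hφ : ∀ j, SupportedIn (Set.Iic 1) (φ j)) (hψ : ∀ j, SupportedIn (Set.Iic 1) (ψ j))
    (hφψ : ∀ j, SupportedIn (Set.Iio 1) (φ j - ψ j)) (u : υ →₀ ℕ) :
    SupportedIn (Set.Iio u.degree)
      ((u.prod fun j n => φ j ^ n) - u.prod fun j n => ψ j ^ n) := by
  classical
  have hV : ∀ a b : ℕ, ∀ x ∈ Set.Iic a, ∀ y ∈ Set.Iic b, x + y ∈ Set.Iic (a + b) :=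
    fun a b x hx y hy => add_le_add (Set.mem_Iic.1 hx) (Set.mem_Iic.1 hy)
  have step : ∀ {P P' Q Q' : MvPolynomial τ (MvPolynomial σ R)} {a b : ℕ},
      SupportedIn (Set.Iic a) P' → SupportedIn (Set.Iic b) Q →
      SupportedIn (Set.Iio a) (P - P') → SupportedIn (Set.Iio b) (Q - Q') →
      SupportedIn (Set.Iio (a + b)) (P * Q - P' * Q') := by
    intro P P' Q Q' a b h1 h2 h3 h4
    have : P * Q - P' * Q' = (P - P') * Q + P' * (Q - Q') := by ring
    rw [this]
    refine (h3.mul h2 ?_).add (h1.mul h4 ?_)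
    · intro x hx y hy; simp only [Set.mem_Iio, Set.mem_Iic] at *; omega
    · intro x hx y hy; simp only [Set.mem_Iio, Set.mem_Iic] at *; omega
  have hz : ∀ D : Set ℕ, SupportedIn D (0 : MvPolynomial τ (MvPolynomial σ R)) :=
    fun D i s h => absurd (by simp) h
  induction u using Finsupp.induction_linear with
  | zero => simpa using hz _
  | add u v hu hv =>
    rw [Finsupp.prod_add_index' (by simp) (fun _ _ _ => pow_add _ _ _),
      Finsupp.prod_add_index' (by simp) (fun _ _ _ => pow_add _ _ _), map_add]
    exact step (supportedIn_prod_pow (V := Set.Iic) (by simp) hV hψ u)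
      (supportedIn_prod_pow (V := Set.Iic) (by simp) hV hφ v) hu hv
  | single j n =>
    rw [Finsupp.prod_single_index (by simp), Finsupp.prod_single_index (by simp),
      Finsupp.degree_single]
    induction n with
    | zero => simpa using hz _
    | succ n ih =>
      rw [pow_succ, pow_succ]
      refine step ?_ (hφ j) ih (hφψ j)
      have := supportedIn_prod_pow (V := Set.Iic) (by simp) hV hψ (Finsupp.single j n)
      rwa [Finsupp.prod_single_index (by simp), Finsupp.degree_single] at this

theorem aeval_eq_sum_prod (φ : υ → MvPolynomial τ (MvPolynomial σ R)) (P : MvPolynomial υ R) :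
    MvPolynomial.aeval φ P = ∑ u ∈ P.support,
      algebraMap R (MvPolynomial τ (MvPolynomial σ R)) (P.coeff u) * u.prod fun j n => φ j ^ n := by
  rw [MvPolynomial.aeval_def, MvPolynomial.eval₂_eq]
  rfl

theorem supportedIn_aeval {V : ℕ → Set ℕ} (h0 : 0 ∈ V 0)
    (hV : ∀ a b, ∀ x ∈ V a, ∀ y ∈ V b, x + y ∈ V (a + b))
    {φ : υ → MvPolynomial τ (MvPolynomial σ R)} (hφ : ∀ j, SupportedIn (V 1) (φ j))
    (P : MvPolynomial υ R) (hP : ∀ u ∈ P.support, V u.degree ⊆ D) :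
    SupportedIn D (MvPolynomial.aeval φ P) := by
  rw [aeval_eq_sum_prod]
  refine SupportedIn.sum _ _ fun u hu => ?_
  refine (supportedIn_algebraMap (D := {0}) (P.coeff u) rfl).mul
    (supportedIn_prod_pow h0 hV hφ u) ?_
  rintro x hx y hy
  rw [Set.mem_singleton_iff.1 hx, zero_add]
  exact hP u hu hy

/-- The substituted terms have no constant part, so the joint order of vanishing is preserved;
passing to the coefficient of `z ^ i`, a Hasse derivative, costs `i.degree`. -/
theorem orderGE_coeff_aeval {φ : υ → MvPolynomial τ (MvPolynomial σ R)}
    (hφ : ∀ j, SupportedIn (Set.Ici 1) (φ j)) {m : ℕ} {P : MvPolynomial υ R} (hP : OrderGE m P)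
    (i : τ →₀ ℕ) : OrderGE (m - i.degree) ((MvPolynomial.aeval φ P).coeff i) := by
  have h : SupportedIn (Set.Ici m) (MvPolynomial.aeval φ P) := by
    refine supportedIn_aeval (V := Set.Ici) (by simp)
      (fun a b x hx y hy => add_le_add (Set.mem_Ici.1 hx) (Set.mem_Ici.1 hy)) hφ P fun u hu => ?_
    refine Set.Ici_subset_Ici.2 ?_
    by_contra hlt
    exact (MvPolynomial.mem_support_iff.1 hu) (hP u (not_le.1 hlt))
  intro s hs
  by_contra h'
  have := Set.mem_Ici.1 (h i s h')
  omega

theorem totalDegree_coeff_aeval_le {φ : υ → MvPolynomial τ (MvPolynomial σ R)}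
    (hφ : ∀ j, SupportedIn (Set.Iic 1) (φ j)) (P : MvPolynomial υ R) (i : τ →₀ ℕ) :
    ((MvPolynomial.aeval φ P).coeff i).totalDegree ≤ P.totalDegree - i.degree := by
  have h : SupportedIn (Set.Iic P.totalDegree) (MvPolynomial.aeval φ P) := by
    refine supportedIn_aeval (V := Set.Iic) (by simp)
      (fun a b x hx y hy => add_le_add (Set.mem_Iic.1 hx) (Set.mem_Iic.1 hy)) hφ P fun u hu => ?_
    exact Set.Iic_subset_Iic.2 (MvPolynomial.le_totalDegree hu)
  refine Finset.sup_le fun s hs => ?_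
  have := Set.mem_Iic.1 (h i s (MvPolynomial.mem_support_iff.1 hs))
  change s.degree ≤ _
  omega

/-- If the coefficient of `z ^ i` in `P(a + ψ)` vanishes, then so does that of the leading form of
`P` evaluated at `ψ`, for homogeneous linear `ψ`. -/
theorem coeff_aeval_homogeneousComponent_eq_zero {φ ψ : υ → MvPolynomial τ (MvPolynomial σ R)}
    (hφ : ∀ j, SupportedIn (Set.Iic 1) (φ j)) (hψ : ∀ j, SupportedIn {1} (ψ j))
    (hφψ : ∀ j, SupportedIn (Set.Iio 1) (φ j - ψ j)) (P : MvPolynomial υ R) (i : τ →₀ ℕ)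
    (h : (MvPolynomial.aeval φ P).coeff i = 0) :
    (MvPolynomial.aeval ψ (P.homogeneousComponent P.totalDegree)).coeff i = 0 := by
  classical
  set d := P.totalDegree with hd
  have hψ' : ∀ j, SupportedIn (Set.Iic 1) (ψ j) := fun j => (hψ j).mono (by simp)
  have hH : SupportedIn {d} (MvPolynomial.aeval ψ (P.homogeneousComponent d)) := by
    refine supportedIn_aeval (V := fun n => {n}) (by simp) (by simp) hψ _ fun u hu => ?_
    rw [MvPolynomial.mem_support_iff, MvPolynomial.coeff_homogeneousComponent] at hu
    simp only [ne_eq, ite_eq_right_iff, not_forall] at hu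
    rw [hu.1]
  -- The difference lives in total degree below `d` and the leading form in degree exactly `d`, so
  -- no coefficient of the leading form can be cancelled.
  have hdiff : SupportedIn (Set.Iio d)
      (MvPolynomial.aeval φ P - MvPolynomial.aeval ψ (P.homogeneousComponent d)) := by
    have hlow : SupportedIn (Set.Iio d) (MvPolynomial.aeval φ (P - P.homogeneousComponent d)) := by
      refine supportedIn_aeval (V := Set.Iic) (by simp)
        (fun a b x hx y hy => add_le_add (Set.mem_Iic.1 hx) (Set.mem_Iic.1 hy)) hφ _
        fun u hu => ?_
      rw [MvPolynomial.mem_support_iff, MvPolynomial.coeff_sub,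
        MvPolynomial.coeff_homogeneousComponent] at hu
      split_ifs at hu with h1
      · simp at hu
      · have h2 : u ∈ P.support := by simpa using hu
        have h3 : u.degree ≤ d := MvPolynomial.le_totalDegree h2
        intro x hx
        exact lt_of_le_of_lt (Set.mem_Iic.1 hx) (lt_of_le_of_ne h3 h1)
    have htop : SupportedIn (Set.Iio d) (MvPolynomial.aeval φ (P.homogeneousComponent d) -
        MvPolynomial.aeval ψ (P.homogeneousComponent d)) := by
      rw [aeval_eq_sum_prod, aeval_eq_sum_prod, ← Finset.sum_sub_distrib]
      refine SupportedIn.sum _ _ fun u hu => ?_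
      rw [← mul_sub]
      refine (supportedIn_algebraMap (D := {0}) _ rfl).mul
        (supportedIn_prod_pow_sub hφ hψ' hφψ u) ?_
      rintro x hx y hy
      rw [MvPolynomial.mem_support_iff, MvPolynomial.coeff_homogeneousComponent] at hu
      simp only [ne_eq, ite_eq_right_iff, not_forall] at hu
      rw [Set.mem_singleton_iff.1 hx, zero_add, ← hu.1]
      exact hy
    have := hlow.add htop
    rw [map_sub] at this
    convert this using 1
    ring
  ext s
  rw [MvPolynomial.coeff_zero]
  by_contra hne
  have h1 := Set.mem_singleton_iff.1 (hH i s hne)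
  have h2 := Set.mem_Iio.1 (hdiff i s (by simpa [h] using hne))
  omega

end SupportedIn

/-! ### Counting monomials and interpolation -/

/-- The exponents of the monomials of degree less than `k` in `N` variables. -/
def lowExponents (N k : ℕ) : Finset (Fin N →₀ ℕ) :=
  (Finset.range k).biUnion fun j => Finset.univ.finsuppAntidiag j

theorem mem_lowExponents {N k : ℕ} {s : Fin N →₀ ℕ} : s ∈ lowExponents N k ↔ s.degree < k := by
  simp [lowExponents, Finset.mem_finsuppAntidiag, Finsupp.degree_eq_sum]

theorem factorial_mul_card_lowExponents (N k : ℕ) :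
    N.factorial * (lowExponents N (k + 1)).card = (k + 1).ascFactorial N := by
  have h : (lowExponents N (k + 1)).card = ∑ j ∈ Finset.range (k + 1), N.multichoose j := by
    rw [lowExponents, Finset.card_biUnion]
    · exact Finset.sum_congr rfl fun j _ => by
        simp [Finset.card_finsuppAntidiag_nat_eq_multichoose]
    · intro i _ j _ hij
      rw [Function.onFun, Finset.disjoint_left]
      intro s hs hs'
      rw [Finset.mem_finsuppAntidiag] at hs hs'
      exact hij (hs.1.symm.trans hs'.1)
  rw [h, Nat.sum_range_multichoose, Nat.ascFactorial_eq_factorial_mul_choose, add_comm k N]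

/-- One factor `k` is kept apart: bounding the others uniformly makes the number of vanishing
conditions linear in the weight. -/
theorem factorial_mul_card_lowExponents_le (N k : ℕ) :
    (N + 1).factorial * (lowExponents (N + 1) k).card ≤ k * (k + (N + 1)) ^ N := by
  cases k with
  | zero => simp [lowExponents]
  | succ k =>
    rw [factorial_mul_card_lowExponents]
    have h : (k + 1).ascFactorial (N + 1) = (k + 1) * (k + 2).ascFactorial N := by
      rw [Nat.succ_ascFactorial]; rfl
    rw [h]
    refine Nat.mul_le_mul_left _ ((Nat.ascFactorial_le_pow_add (k + 1) N).trans ?_)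
    exact Nat.pow_le_pow_left (by omega) _

theorem pow_le_factorial_mul_card_lowExponents (N d : ℕ) :
    d ^ N ≤ N.factorial * (lowExponents N (d + 1)).card := by
  rw [factorial_mul_card_lowExponents]
  exact (Nat.pow_le_pow_left d.le_succ _).trans (Nat.pow_succ_le_ascFactorial (d + 1) N)

/-- If the number of linear conditions is less than the number of monomials of degree at most `d`,
some nonzero polynomial of degree at most `d` has the prescribed multiplicities. -/
theorem exists_polynomial_vanishing {F : Type*} [Field F] [Fintype F] (N : ℕ) (d : ℕ)
    (M : (Fin N → F) → ℕ) (h : ∑ y, (lowExponents N (M y)).card < (lowExponents N (d + 1)).card) :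
    ∃ P : MvPolynomial (Fin N) F, P ≠ 0 ∧ P.totalDegree ≤ d ∧ ∀ y, VanishesAt y (M y) P := by
  classical
  let toPoly : (lowExponents N (d + 1) → F) →ₗ[F] MvPolynomial (Fin N) F :=
    ∑ s, (MvPolynomial.monomial s.1).comp (LinearMap.proj s)
  have htoPoly : ∀ c, toPoly c = ∑ s, MvPolynomial.monomial s.1 (c s) := by
    intro c; simp [toPoly]
  have hcoeff : ∀ c (s : lowExponents N (d + 1)), (toPoly c).coeff s.1 = c s := by
    intro c s
    rw [htoPoly, MvPolynomial.coeff_sum, Finset.sum_eq_single s]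
    · simp
    · intro b _ hb
      rw [MvPolynomial.coeff_monomial, if_neg fun h => hb (Subtype.ext h)]
    · simp
  let ev : (lowExponents N (d + 1) → F) →ₗ[F] ((Σ y, lowExponents N (M y)) → F) :=
    LinearMap.pi fun p => (MvPolynomial.lcoeff F p.2.1).comp
      ((shiftVars p.1).toLinearMap.comp toPoly)
  have hker : LinearMap.ker ev ≠ ⊥ := by
    refine LinearMap.ker_ne_bot_of_finrank_lt ?_
    simpa [Module.finrank_fintype_fun_eq_card, Fintype.card_sigma] using h
  obtain ⟨c, hc, hc0⟩ := Submodule.exists_mem_ne_zero_of_ne_bot hker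
  refine ⟨toPoly c, ?_, ?_, ?_⟩
  · intro h0
    refine hc0 (funext fun s => ?_)
    rw [← hcoeff c s, h0]; simp
  · rw [htoPoly]
    refine MvPolynomial.totalDegree_finsetSum_le fun s _ => ?_
    refine (MvPolynomial.totalDegree_monomial_le _ _).trans ?_
    have : s.1.degree < d + 1 := mem_lowExponents.1 s.2
    exact Nat.lt_succ_iff.1 this
  · intro y s hs
    exact congrFun (LinearMap.mem_ker.1 hc) ⟨y, s, mem_lowExponents.2 hs⟩

/-! ### Restriction to planes and leading forms -/

/-- Parametrisation by `F ^ σ` of the subspace spanned by the vectors `k b`. -/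
noncomputable def spanMap {σ K : Type*} [Fintype σ] [CommSemiring K] {N : ℕ} (k : σ → Fin N → K)
    (s : σ → K) : Fin N → K := fun j => ∑ b, s b * k b j

theorem supportedIn_C_C {σ τ F : Type*} [CommRing F] (D : Set ℕ) (hD : 0 ∈ D) (a : F) :
    SupportedIn D (MvPolynomial.C (MvPolynomial.C a) : MvPolynomial τ (MvPolynomial σ F)) :=
  supportedIn_algebraMap a hD

section Restriction

variable {σ F : Type*} [Fintype σ] [Field F] {N : ℕ}

/-- The generic point `∑ b, X b • k b + z` of the iterated polynomial ring. -/
noncomputable def genericSpanPoint (k : σ → Fin N → F) (j : Fin N) :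
    MvPolynomial (Fin N) (MvPolynomial σ F) :=
  MvPolynomial.C (∑ b, MvPolynomial.X b * MvPolynomial.C (k b j)) + MvPolynomial.X j

theorem supportedIn_genericSpanPoint (k : σ → Fin N → F) (j : Fin N) :
    SupportedIn {1} (genericSpanPoint k j) := by
  classical
  refine SupportedIn.add ?_ ?_
  · intro i s h
    rw [MvPolynomial.coeff_C] at h
    split_ifs at h with hi
    · rw [MvPolynomial.coeff_sum] at h
      obtain ⟨b, -, hb⟩ := Finset.exists_ne_zero_of_sum_ne_zero h
      rw [mul_comm, MvPolynomial.coeff_C_mul] at hb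
      have := right_ne_zero_of_mul hb
      rw [MvPolynomial.coeff_X] at this
      simp only [ne_eq, ite_eq_right_iff, one_ne_zero, imp_false, not_not] at this
      simp [← hi, ← this]
    · simp at h
  · intro i s h
    rw [MvPolynomial.coeff_X] at h
    split_ifs at h with hi
    · have hs : s = 0 := by
        by_contra hs
        exact h (by rw [MvPolynomial.coeff_one, if_neg (Ne.symm hs)])
      simp [← hi, hs]
    · simp at h

/-- The polynomial `P(a + ∑ b, X b • k b + z)`. -/
noncomputable def restrictGeneric (k : σ → Fin N → F) (a : Fin N → F) :
    MvPolynomial (Fin N) F →ₐ[F] MvPolynomial (Fin N) (MvPolynomial σ F) :=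
  MvPolynomial.aeval fun j => MvPolynomial.C (MvPolynomial.C (a j)) + genericSpanPoint k j

/-- Moving by `s` inside the plane is the same as expanding `P` about the point `a + spanMap k s`,
so the multiplicities of `P` pass to the restricted Hasse derivatives. -/
theorem map_shiftVars_restrictGeneric (k : σ → Fin N → F) (a : Fin N → F) (s : σ → F)
    (P : MvPolynomial (Fin N) F) :
    MvPolynomial.map (shiftVars s).toRingHom (restrictGeneric k a P) =
      MvPolynomial.aeval (genericSpanPoint k) (shiftVars (a + spanMap k s) P) := by
  induction P using MvPolynomial.induction_on with
  | C r =>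
    rw [shiftVars_C, MvPolynomial.algHom_C, MvPolynomial.algHom_C]
    change MvPolynomial.map _ (MvPolynomial.C (MvPolynomial.C r)) =
      MvPolynomial.C (MvPolynomial.C r)
    rw [MvPolynomial.map_C]
    exact congrArg MvPolynomial.C (shiftVars_C s r)
  | add p q hp hq => simp only [map_add, hp, hq]
  | mul_X p j hp =>
    rw [map_mul, map_mul, map_mul, map_mul, hp]
    have h1 : (shiftVars s).toRingHom (∑ b, MvPolynomial.X b * MvPolynomial.C (k b j)) =
        (∑ b, MvPolynomial.X b * MvPolynomial.C (k b j)) +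
          MvPolynomial.C (spanMap k s j) := by
      change shiftVars s _ = _
      rw [map_sum, spanMap, map_sum, ← Finset.sum_add_distrib]
      refine Finset.sum_congr rfl fun b _ => ?_
      rw [map_mul, shiftVars_X, shiftVars_C, MvPolynomial.C_mul, add_mul]
    have h0 : (shiftVars s).toRingHom (MvPolynomial.C (a j)) = MvPolynomial.C (a j) :=
      shiftVars_C s (a j)
    have h2 : MvPolynomial.aeval (genericSpanPoint k) (MvPolynomial.C ((a + spanMap k s) j)) =
        MvPolynomial.C (MvPolynomial.C ((a + spanMap k s) j)) := MvPolynomial.algHom_C _ _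
    have h3 : MvPolynomial.map (shiftVars s).toRingHom (restrictGeneric k a (MvPolynomial.X j)) =
        MvPolynomial.aeval (genericSpanPoint k) (shiftVars (a + spanMap k s) (MvPolynomial.X j)) := by
      rw [shiftVars_X, map_add, MvPolynomial.aeval_X, h2, restrictGeneric, MvPolynomial.aeval_X,
        map_add, MvPolynomial.map_C, h0, genericSpanPoint, map_add, MvPolynomial.map_C, h1,
        MvPolynomial.map_X, Pi.add_apply]
      simp only [MvPolynomial.C_add]
      ring
    rw [h3]

/-- Specialising the plane parameters, possibly in an extension field, turns an identity of
polynomials on the plane into vanishing at each of its `K`-points. -/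
theorem map_aeval_genericSpanPoint {K : Type*} [Field K] [Algebra F K] (k : σ → Fin N → F)
    (θ : σ → K) (P : MvPolynomial (Fin N) F) :
    MvPolynomial.map (MvPolynomial.aeval θ).toRingHom (MvPolynomial.aeval (genericSpanPoint k) P) =
      shiftVars (spanMap (fun b j => algebraMap F K (k b j)) θ)
        (MvPolynomial.map (algebraMap F K) P) := by
  induction P using MvPolynomial.induction_on with
  | C r =>
    rw [MvPolynomial.map_C, shiftVars_C, MvPolynomial.algHom_C]
    have h1 : algebraMap F (MvPolynomial (Fin N) (MvPolynomial σ F)) r =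
      MvPolynomial.C (MvPolynomial.C r) := rfl
    have h2 : (MvPolynomial.aeval θ).toRingHom (MvPolynomial.C r) = algebraMap F K r :=
      MvPolynomial.aeval_C θ r
    rw [h1, MvPolynomial.map_C, h2]
  | add p q hp hq => simp only [map_add, hp, hq]
  | mul_X p j hp =>
    rw [map_mul, map_mul, map_mul, map_mul, hp]
    have h1 : (MvPolynomial.aeval θ).toRingHom (∑ b, MvPolynomial.X b * MvPolynomial.C (k b j)) =
        spanMap (fun b j => algebraMap F K (k b j)) θ j := by
      change MvPolynomial.aeval θ _ = _
      simp [spanMap]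
    have h3 : MvPolynomial.map (MvPolynomial.aeval θ).toRingHom
        (MvPolynomial.aeval (genericSpanPoint k) (MvPolynomial.X j : MvPolynomial (Fin N) F)) =
        shiftVars (spanMap (fun b j => algebraMap F K (k b j)) θ)
        (MvPolynomial.map (algebraMap F K) (MvPolynomial.X j)) := by
      rw [MvPolynomial.aeval_X, MvPolynomial.map_X, shiftVars_X, genericSpanPoint, map_add,
        MvPolynomial.map_C, h1, MvPolynomial.map_X, add_comm]
    rw [h3]

/-- If `P` vanishes to high order along the affine subspace `a + span k`, its leading form vanishes
to order `ℓ` at all points of `span k`, also over extension fields. -/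
theorem vanishesAt_homogeneousComponent {K : Type*} [Field K] [Algebra F K] [Fintype F]
    {P : MvPolynomial (Fin N) F} (k : Fin 2 → Fin N → F) (a : Fin N → F)
    (M : (Fin N → F) → ℕ) (hM : ∀ y, VanishesAt y (M y) P) (ℓ : ℕ)
    (hℓ : ∀ w < ℓ, (P.totalDegree - w) * Fintype.card F <
      ∑ s : Fin 2 → F, (M (a + spanMap k s) - w))
    (θ : Fin 2 → K) :
    VanishesAt (spanMap (fun b j => algebraMap F K (k b j)) θ) ℓ
      (MvPolynomial.map (algebraMap F K) (P.homogeneousComponent P.totalDegree)) := by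
  classical
  have hg1 : ∀ j, SupportedIn {1} (genericSpanPoint k j) := supportedIn_genericSpanPoint k
  have hgI : ∀ j, SupportedIn (Set.Iic 1) (genericSpanPoint k j) := fun j => (hg1 j).mono (by simp)
  have hgJ : ∀ j, SupportedIn (Set.Ici 1) (genericSpanPoint k j) := fun j => (hg1 j).mono (by simp)
  have hφ : ∀ j, SupportedIn (Set.Iic 1)
      (MvPolynomial.C (MvPolynomial.C (a j)) + genericSpanPoint k j) :=
    fun j => (supportedIn_C_C _ (by simp) (a j)).add (hgI j)
  have hφψ : ∀ j, SupportedIn (Set.Iio 1)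
      (MvPolynomial.C (MvPolynomial.C (a j)) + genericSpanPoint k j - genericSpanPoint k j) := fun j => by
    rw [add_sub_cancel_right]; exact supportedIn_C_C _ (by simp) (a j)
  intro i hi
  -- This is the Hasse derivative of index `i` restricted to the plane. If it were nonzero,
  -- Schwartz-Zippel on `F ^ 2` would contradict `hℓ`.
  have hR : (restrictGeneric k a P).coeff i = 0 := by
    by_contra hne
    have hv : ∀ s ∈ Fintype.piFinset (fun _ : Fin 2 => (Finset.univ : Finset F)),
        VanishesAt s (M (a + spanMap k s) - i.degree) ((restrictGeneric k a P).coeff i) := by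
      intro s _
      have h1 := orderGE_coeff_aeval hgJ (hM (a + spanMap k s)) i
      rw [← map_shiftVars_restrictGeneric, MvPolynomial.coeff_map] at h1
      exact h1
    have h2 := sum_multiplicity_le Finset.univ 2 _ hne _ hv
    have h3 := totalDegree_coeff_aeval_le hφ P i
    have h4 := hℓ _ hi
    rw [Fintype.piFinset_univ, Finset.card_univ] at h2
    have hq : 0 < Fintype.card F := Fintype.card_pos
    have h5 : Fintype.card F * ∑ s : Fin 2 → F, (M (a + spanMap k s) - i.degree) ≤
        Fintype.card F * ((P.totalDegree - i.degree) * Fintype.card F) := by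
      refine h2.trans ?_
      calc _ ≤ (P.totalDegree - i.degree) * Fintype.card F ^ 2 := Nat.mul_le_mul_right _ h3
        _ = _ := by ring
    exact absurd (Nat.le_of_mul_le_mul_left h5 hq) (not_le.2 h4)
  have h := coeff_aeval_homogeneousComponent_eq_zero hφ hg1 hφψ P i hR
  rw [← map_aeval_genericSpanPoint, MvPolynomial.coeff_map, h, map_zero]

end Restriction

theorem homogeneousComponent_totalDegree_ne_zero {σ R : Type*} [CommSemiring R]
    {P : MvPolynomial σ R} (hP : P ≠ 0) : P.homogeneousComponent P.totalDegree ≠ 0 := by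
  classical
  have hne : P.support.Nonempty := by
    rw [Finset.nonempty_iff_ne_empty]; simpa using hP
  obtain ⟨s, hs, h⟩ := Finset.exists_mem_eq_sup P.support hne fun s => s.sum fun _ e => e
  intro h0
  have h1 := MvPolynomial.coeff_homogeneousComponent P.totalDegree P s
  have h2 : s.degree = P.totalDegree := h.symm
  rw [h0, MvPolynomial.coeff_zero, if_pos h2] at h1
  exact (MvPolynomial.mem_support_iff.1 hs) h1.symm

/-! ### The weighted Kakeya bound for pairs of directions -/

/-- The cap `C` on the weights enters here: it bounds all but one factor of each count, leaving only
the total weight `W`. -/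
theorem sum_card_lowExponents_lt {F : Type*} [Fintype F] {N : ℕ} (w : (Fin (N + 1) → F) → ℕ)
    {C W m d : ℕ} (hw : ∀ y, w y ≤ C) (hW : ∑ y, w y ≤ W)
    (h : m * W * (m * C + (N + 1)) ^ N < d ^ (N + 1)) :
    ∑ y, (lowExponents (N + 1) (m * w y)).card < (lowExponents (N + 1) (d + 1)).card := by
  refine lt_of_mul_lt_mul_left (a := (N + 1).factorial) ?_ (Nat.zero_le _)
  refine lt_of_lt_of_le ?_ (pow_le_factorial_mul_card_lowExponents (N + 1) d)
  refine lt_of_le_of_lt ?_ h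
  rw [Finset.mul_sum]
  calc ∑ y, (N + 1).factorial * (lowExponents (N + 1) (m * w y)).card
      ≤ ∑ y, m * w y * (m * C + (N + 1)) ^ N := Finset.sum_le_sum fun y _ => by
        refine (factorial_mul_card_lowExponents_le N (m * w y)).trans ?_
        have := hw y
        gcongr
    _ = m * (∑ y, w y) * (m * C + (N + 1)) ^ N := by
        rw [← Finset.sum_mul, ← Finset.mul_sum]
    _ ≤ _ := by gcongr

/-- Any `T` outside `F` works, since 1 and `T` are then linearly independent over `F`; the algebraic
closure is infinite, so it has such elements. -/
theorem exists_grid_generator (F : Type*) [Field F] [Finite F] : ∃ T : AlgebraicClosure F,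
    Function.Injective fun p : F × F =>
      algebraMap F (AlgebraicClosure F) p.1 + algebraMap F (AlgebraicClosure F) p.2 * T := by
  obtain ⟨T, hT⟩ := (Set.finite_range (algebraMap F (AlgebraicClosure F))).exists_notMem
  refine ⟨T, fun p p' h => ?_⟩
  dsimp only at h
  have h2 : p.2 = p'.2 := by
    by_contra hne
    refine hT ⟨(p'.1 - p.1) / (p.2 - p'.2), ?_⟩
    have hne' : algebraMap F (AlgebraicClosure F) (p.2 - p'.2) ≠ 0 := by
      simpa [sub_eq_zero] using hne
    rw [map_div₀, div_eq_iff hne', map_sub, map_sub]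
    linear_combination -h
  rw [h2, add_left_inj] at h
  exact Prod.ext ((algebraMap F _).injective h) h2

/-- If for every pair of directions `v ∈ Ω` the weight `w` is large on a translate of a subspace
containing `v.1` and `v.2`, then `Ω` is small, provided a polynomial with large multiplicities
exists. -/
theorem card_directions_mul_le {F : Type*} [Field F] [Fintype F] {N : ℕ}
    (w : (Fin (N + 1) → F) → ℕ) {C W B m d ℓ : ℕ} (hw : ∀ y, w y ≤ C) (hW : ∑ y, w y ≤ W)
    (Ω : Finset ((Fin (N + 1) → F) × (Fin (N + 1) → F)))
    (hΩ : ∀ v ∈ Ω, ∃ (k : Fin 2 → Fin (N + 1) → F) (a : Fin (N + 1) → F) (s₁ s₂ : Fin 2 → F),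
      spanMap k s₁ = v.1 ∧ spanMap k s₂ = v.2 ∧ B ≤ ∑ s, w (a + spanMap k s))
    (h1 : m * W * (m * C + (N + 1)) ^ N < d ^ (N + 1))
    (h2 : d * Fintype.card F + ℓ * Fintype.card F ^ 2 ≤ m * B) :
    Fintype.card F ^ 2 * (Ω.card * ℓ) ≤ d * (Fintype.card F ^ 2) ^ (N + 1) := by
  classical
  set q := Fintype.card F with hq
  have hqpos : 0 < q := Fintype.card_pos
  obtain ⟨P, hP0, hPd, hPv⟩ := exists_polynomial_vanishing (N + 1) d (fun y => m * w y)
    (sum_card_lowExponents_lt w hw hW h1)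
  obtain ⟨T, hT⟩ := exists_grid_generator F
  set α := algebraMap F (AlgebraicClosure F) with hα
  set H := MvPolynomial.map α (P.homogeneousComponent P.totalDegree) with hH
  have hH0 : H ≠ 0 := by
    rw [hH, Ne, map_eq_zero_iff _ (MvPolynomial.map_injective α α.injective)]
    exact homogeneousComponent_totalDegree_ne_zero hP0
  have hHd : H.totalDegree ≤ d := by
    refine le_trans ?_ ((MvPolynomial.homogeneousComponent_isHomogeneous
      P.totalDegree P).totalDegree_le.trans hPd)
    exact Finset.sup_mono (MvPolynomial.support_map_subset _ _)
  let G : Finset (AlgebraicClosure F) := Finset.univ.image fun p : F × F => α p.1 + α p.2 * T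
  have hGcard : G.card = q ^ 2 := by
    rw [Finset.card_image_of_injective _ hT, Finset.card_univ, Fintype.card_prod, sq]
  let pt : (Fin (N + 1) → F) × (Fin (N + 1) → F) → Fin (N + 1) → AlgebraicClosure F :=
    fun v j => α (v.1 j) + α (v.2 j) * T
  have hpt : Function.Injective pt := by
    intro v v' h
    have h' : ∀ j, (v.1 j, v.2 j) = (v'.1 j, v'.2 j) := fun j => hT (congrFun h j)
    exact Prod.ext (funext fun j => congrArg Prod.fst (h' j))
      (funext fun j => congrArg Prod.snd (h' j))
  have hvan : ∀ v ∈ Ω, VanishesAt (pt v) ℓ H := by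
    intro v hv
    obtain ⟨k, a, s₁, s₂, hs₁, hs₂, hB⟩ := hΩ v hv
    have h3 := vanishesAt_homogeneousComponent (K := AlgebraicClosure F) k a
      (fun y => m * w y) hPv ℓ ?_ (fun b => α (s₁ b) + α (s₂ b) * T)
    · convert h3 using 1
      funext j
      simp only [pt, spanMap, ← hs₁, ← hs₂, map_sum, map_mul, Finset.sum_mul,
        ← Finset.sum_add_distrib]
      exact Finset.sum_congr rfl fun b _ => by ring
    · intro u hu
      -- Truncated subtraction loses at most `u` at each of the `q ^ 2` points. As `u < ℓ`, one
      -- spare `q ^ 2` remains, which gives the strict inequality.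
      have h4 : m * B ≤ ∑ s : Fin 2 → F, (m * w (a + spanMap k s) - u) + u * q ^ 2 := by
        calc m * B ≤ m * ∑ s : Fin 2 → F, w (a + spanMap k s) := Nat.mul_le_mul_left _ hB
          _ = ∑ s : Fin 2 → F, m * w (a + spanMap k s) := Finset.mul_sum ..
          _ ≤ ∑ s : Fin 2 → F, ((m * w (a + spanMap k s) - u) + u) :=
            Finset.sum_le_sum fun s _ => by omega
          _ = _ := by simp [Finset.sum_add_distrib, mul_comm, hq]
      have h5 : (P.totalDegree - u) * q ≤ d * q := Nat.mul_le_mul_right _ (by omega)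
      have h6 : (u + 1) * q ^ 2 ≤ ℓ * q ^ 2 := Nat.mul_le_mul_right _ hu
      have h7 : 0 < q ^ 2 := by positivity
      rw [add_mul, one_mul] at h6
      rw [← hq]
      omega
  have hSZ := sum_multiplicity_le G (N + 1) H hH0
    (fun x => if x ∈ Ω.image pt then ℓ else 0) (fun x _ => by
      split_ifs with hx
      · obtain ⟨v, hv, rfl⟩ := Finset.mem_image.1 hx
        exact hvan v hv
      · intro s hs; omega)
  rw [hGcard] at hSZ
  refine le_trans (Nat.mul_le_mul_left _ ?_) (hSZ.trans (Nat.mul_le_mul_right _ hHd))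
  rw [Finset.sum_ite_mem, Finset.sum_const, smul_eq_mul]
  refine Nat.mul_le_mul_right _ ?_
  rw [← Finset.card_image_of_injective Ω hpt]
  refine Finset.card_le_card fun x hx => Finset.mem_inter.2 ⟨?_, hx⟩
  obtain ⟨v, -, rfl⟩ := Finset.mem_image.1 hx
  exact Fintype.mem_piFinset.2 fun j => Finset.mem_image.2 ⟨(v.1 j, v.2 j), Finset.mem_univ _, rfl⟩

-- Both sides have order `m ^ (N + 1)`; after division by it, the limits compare by the hypothesis
-- times `C ^ N`.
open Filter Topology in
theorem eventually_mul_pow_lt {N : ℕ} {W C θ q : ℝ} (hC : 0 < C)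
    (h : W < θ ^ (N + 1) * (C * q ^ (N + 1))) :
    ∀ᶠ m : ℕ in atTop, m * W * (m * C + (N + 1)) ^ N < (θ * m * C * q - 1) ^ (N + 1) := by
  have hlim : Tendsto (fun m : ℕ => ((m : ℝ))⁻¹) atTop (𝓝 0) :=
    tendsto_inv_atTop_nhds_zero_nat
  have h1 : Tendsto (fun m : ℕ => W * (C + (N + 1) * ((m : ℝ))⁻¹) ^ N) atTop
      (𝓝 (W * (C + (N + 1) * 0) ^ N)) :=
    (((hlim.const_mul _).const_add _).pow N).const_mul _
  have h2 : Tendsto (fun m : ℕ => (θ * C * q - ((m : ℝ))⁻¹) ^ (N + 1)) atTop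
      (𝓝 ((θ * C * q - 0) ^ (N + 1))) := (hlim.const_sub _).pow _
  have h3 : W * (C + (N + 1) * 0) ^ N < (θ * C * q - 0) ^ (N + 1) := by
    have : W * C ^ N < θ ^ (N + 1) * (C * q ^ (N + 1)) * C ^ N :=
      mul_lt_mul_of_pos_right h (by positivity)
    calc W * (C + (N + 1) * 0) ^ N = W * C ^ N := by rw [mul_zero, add_zero]
      _ < θ ^ (N + 1) * (C * q ^ (N + 1)) * C ^ N := this
      _ = (θ * C * q - 0) ^ (N + 1) := by ring
  filter_upwards [h1.eventually_lt h2 h3, eventually_gt_atTop 0] with m hm hm0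
  have hm0' : (0 : ℝ) < m := by exact_mod_cast hm0
  have e1 : (m : ℝ) * W * (m * C + (N + 1)) ^ N =
      m ^ (N + 1) * (W * (C + (N + 1) * ((m : ℝ))⁻¹) ^ N) := by
    have : (m : ℝ) * C + (N + 1) = m * (C + (N + 1) * ((m : ℝ))⁻¹) := by field_simp
    rw [this, mul_pow]; ring
  have e2 : (θ * m * C * q - 1) ^ (N + 1) =
      (m : ℝ) ^ (N + 1) * (θ * C * q - ((m : ℝ))⁻¹) ^ (N + 1) := by
    rw [← mul_pow]; congr 1; field_simp
  rw [e1, e2]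
  exact mul_lt_mul_of_pos_left hm (by positivity)

open Filter Topology in
/-- A lower bound for the total weight of a weight function that is large on a translate of a plane
in each direction of a set of directions of density at least `ρ`. -/
theorem weighted_kakeya_bound {F : Type*} [Field F] [Fintype F] {N : ℕ}
    (w : (Fin (N + 1) → F) → ℕ) {C W : ℕ} (hC : 0 < C) (hw : ∀ y, w y ≤ C) (hW : ∑ y, w y ≤ W)
    {β ρ : ℝ} (hβ : 0 < β) (hρ : 0 < ρ)
    (Ω : Finset ((Fin (N + 1) → F) × (Fin (N + 1) → F)))
    (hΩ : ∀ v ∈ Ω, ∃ (k : Fin 2 → Fin (N + 1) → F) (a : Fin (N + 1) → F) (s₁ s₂ : Fin 2 → F),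
      spanMap k s₁ = v.1 ∧ spanMap k s₂ = v.2 ∧
        β * C * (Fintype.card F : ℝ) ^ 2 ≤ ∑ s, (w (a + spanMap k s) : ℝ))
    (hΩρ : ρ * ((Fintype.card F : ℝ) ^ 2) ^ (N + 1) ≤ Ω.card) :
    (β / (1 + 1 / (ρ * Fintype.card F))) ^ (N + 1) ≤
      W / (C * (Fintype.card F : ℝ) ^ (N + 1)) := by
  set q := Fintype.card F with hq
  have hqpos : 0 < q := Fintype.card_pos
  have hq0 : (0 : ℝ) < q := by exact_mod_cast hqpos
  have hC0 : (0 : ℝ) < C := by exact_mod_cast hC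
  by_contra hcon
  rw [not_le] at hcon
  set x₀ := β / (1 + 1 / (ρ * q)) with hx₀
  have hden : 0 < 1 + 1 / (ρ * q) := by positivity
  have hx₀pos : 0 < x₀ := by positivity
  -- Lowering `x₀` slightly to `θ` keeps the assumed failure strict and leaves a gap that absorbs
  -- all rounding once `m` is large.
  obtain ⟨θ, hθ, hθ0, hθx⟩ : ∃ θ : ℝ, (W : ℝ) / (C * (q : ℝ) ^ (N + 1)) < θ ^ (N + 1) ∧ 0 < θ ∧
      θ < x₀ := by
    have h1 : ∀ᶠ θ in 𝓝[<] x₀, (W : ℝ) / (C * (q : ℝ) ^ (N + 1)) < θ ^ (N + 1) :=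
      (((continuous_pow (N + 1)).tendsto x₀).mono_left nhdsWithin_le_nhds).eventually
        (lt_mem_nhds hcon)
    have h2 : ∀ᶠ θ in 𝓝[<] x₀, 0 < θ := nhdsWithin_le_nhds (lt_mem_nhds hx₀pos)
    exact (h1.and (h2.and self_mem_nhdsWithin)).exists
  have hgap : 0 < β - θ * (1 + 1 / (ρ * q)) := by
    rw [hx₀, lt_div_iff₀ hden] at hθx
    linarith
  have hθ' : (W : ℝ) < θ ^ (N + 1) * (C * (q : ℝ) ^ (N + 1)) := by
    rwa [div_lt_iff₀ (by positivity)] at hθ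
  have hlarge : ∀ᶠ m : ℕ in atTop, 1 / (C * (β - θ * (1 + 1 / (ρ * q)))) ≤ (m : ℝ) :=
    tendsto_natCast_atTop_atTop.eventually_ge_atTop _
  have hlarge' : ∀ᶠ m : ℕ in atTop, 1 / (θ * C * q) ≤ (m : ℝ) :=
    tendsto_natCast_atTop_atTop.eventually_ge_atTop _
  obtain ⟨m, hm1, hm2, hm3⟩ :=
    ((eventually_mul_pow_lt hC0 hθ').and (hlarge.and hlarge')).exists
  rw [div_le_iff₀ (by positivity)] at hm2 hm3
  set d := ⌊θ * m * C * q⌋₊ with hd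
  -- The least order for which vanishing on a fraction `ρ` of the grid exceeds what degree `d`
  -- allows.
  set ℓ := ⌊(d : ℝ) / (ρ * q ^ 2)⌋₊ + 1 with hℓ
  have hd1 : (d : ℝ) ≤ θ * m * C * q := Nat.floor_le (by positivity)
  have hd2 : θ * m * C * q - 1 < d := Nat.sub_one_lt_floor _
  have hℓ1 : (ℓ : ℝ) ≤ d / (ρ * q ^ 2) + 1 := by
    rw [hℓ]; push_cast
    have := Nat.floor_le (show 0 ≤ (d : ℝ) / (ρ * q ^ 2) by positivity)
    linarith
  have hℓ2 : (d : ℝ) / (ρ * q ^ 2) < ℓ := by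
    rw [hℓ]; push_cast
    exact Nat.lt_floor_add_one _
  have key := card_directions_mul_le (B := ⌈β * C * (q : ℝ) ^ 2⌉₊) (m := m) (d := d) (ℓ := ℓ)
    w hw hW Ω ?_ ?_ ?_
  · rw [← hq] at key
    have key' : ((q : ℝ) ^ 2) * (Ω.card * ℓ) ≤ d * ((q : ℝ) ^ 2) ^ (N + 1) := by
      exact_mod_cast key
    rw [div_lt_iff₀ (by positivity)] at hℓ2
    have hpow : (0 : ℝ) < ((q : ℝ) ^ 2) ^ (N + 1) := by positivity
    have h1 : (d : ℝ) * ((q : ℝ) ^ 2) ^ (N + 1) <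
        ℓ * (ρ * q ^ 2) * ((q : ℝ) ^ 2) ^ (N + 1) := mul_lt_mul_of_pos_right hℓ2 hpow
    have h2 : ((q : ℝ) ^ 2 * ℓ) * (ρ * ((q : ℝ) ^ 2) ^ (N + 1)) ≤ ((q : ℝ) ^ 2 * ℓ) * Ω.card :=
      mul_le_mul_of_nonneg_left hΩρ (by positivity)
    linarith
  · intro v hv
    obtain ⟨k, a, s₁, s₂, h1, h2, h3⟩ := hΩ v hv
    refine ⟨k, a, s₁, s₂, h1, h2, ?_⟩
    rw [Nat.ceil_le]
    exact_mod_cast h3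
  · have : (m : ℝ) * W * (m * C + (N + 1)) ^ N < (d : ℝ) ^ (N + 1) := by
      refine hm1.trans_le (pow_le_pow_left₀ ?_ hd2.le _)
      linarith
    exact_mod_cast this
  · have h4 : (d : ℝ) * q + ℓ * q ^ 2 ≤ m * (β * C * q ^ 2) := by
      calc (d : ℝ) * q + ℓ * q ^ 2 ≤ d * q + (d / (ρ * q ^ 2) + 1) * q ^ 2 := by gcongr
        _ = d * q * (1 + 1 / (ρ * q)) + q ^ 2 := by field_simp; ring
        _ ≤ (θ * m * C * q) * q * (1 + 1 / (ρ * q)) +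
            (m * (C * (β - θ * (1 + 1 / (ρ * q))))) * q ^ 2 := by
          gcongr
          exact le_mul_of_one_le_left (by positivity) hm2
        _ = m * (β * C * q ^ 2) := by ring
    have h5 : (d : ℝ) * q + ℓ * q ^ 2 ≤ m * (⌈β * C * (q : ℝ) ^ 2⌉₊ : ℝ) :=
      h4.trans (by gcongr; exact Nat.le_ceil _)
    exact_mod_cast h5

/-! ### Second moments of the fibres of random linear maps -/

theorem card_filter_map_eq_zero_mul_card {G H : Type*} [AddGroup G] [AddGroup H] [Fintype G]
    [Fintype H] [DecidableEq H] (f : G →+ H) (hf : Function.Surjective f) :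
    (Finset.univ.filter fun g => f g = 0).card * Fintype.card H = Fintype.card G := by
  have h : Fintype.card G = ∑ y : H, (Finset.univ.filter fun g => f g = y).card :=
    Finset.card_eq_sum_card_fiberwise fun g _ => Finset.mem_coe.2 (Finset.mem_univ _)
  rw [h, Finset.sum_congr rfl fun y _ =>
    AddMonoidHom.card_fiber_eq_of_mem_range f (hf y) (hf 0), Finset.sum_const, smul_eq_mul,
    mul_comm, Finset.card_univ]

theorem exists_linearMap_apply_eq {F W : Type*} [Field F] [AddCommGroup W] [Module F W] {n : ℕ}
    {x : Fin n → F} (hx : x ≠ 0) (y : W) :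
    ∃ Q : (Fin n → F) →ₗ[F] W, Q x = y := by
  obtain ⟨j, hj⟩ := Function.ne_iff.1 hx
  refine ⟨(LinearMap.proj j).smulRight ((x j)⁻¹ • y), ?_⟩
  rw [LinearMap.smulRight_apply, LinearMap.proj_apply, smul_smul, mul_inv_cancel₀ hj, one_smul]

/-- The number of elements of `T` in the fibre of `Q` over `z`. -/
def fiberCount {V U : Type*} [DecidableEq U] (T : Finset V) (Q : V → U) (z : U) : ℕ :=
  (T.filter fun x => Q x = z).card

theorem sum_fiberCount {V W : Type*} [Fintype W] [DecidableEq W] (T : Finset V) (Q : V → W) :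
    ∑ z, fiberCount T Q z = T.card :=
  (Finset.card_eq_sum_card_fiberwise fun x _ => Finset.mem_coe.2 (Finset.mem_univ (Q x))).symm

theorem sum_fiberCount_sq {V W : Type*} [Fintype W] [DecidableEq W] (T : Finset V) (Q : V → W) :
    ∑ z, fiberCount T Q z ^ 2 = ∑ x ∈ T, ∑ x' ∈ T, if Q x = Q x' then 1 else 0 := by
  have h1 : ∀ x ∈ T, (∑ x' ∈ T, if Q x = Q x' then 1 else 0) = fiberCount T Q (Q x) := by
    intro x _
    rw [fiberCount, Finset.card_filter]
    exact Finset.sum_congr rfl fun x' _ => by simp only [eq_comm]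
  rw [Finset.sum_congr rfl h1, ← Finset.sum_fiberwise_of_maps_to (t := Finset.univ) (g := Q)
    fun x _ => Finset.mem_univ _]
  refine Finset.sum_congr rfl fun z _ => ?_
  rw [Finset.sum_congr rfl (g := fun _ => fiberCount T Q z), Finset.sum_const, smul_eq_mul, sq]
  · rfl
  · intro x hx
    rw [(Finset.mem_filter.1 hx).2]

section RandomMaps

variable {F W : Type*} [Field F] [AddCommGroup W] [Module F W] {n : ℕ}

variable [Fintype W] [DecidableEq W] [Fintype ((Fin n → F) →ₗ[F] W)]

theorem card_filter_apply_eq_zero_mul_card {x : Fin n → F} (hx : x ≠ 0) :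
    (Finset.univ.filter fun Q : (Fin n → F) →ₗ[F] W => Q x = 0).card * Fintype.card W =
      Fintype.card ((Fin n → F) →ₗ[F] W) :=
  card_filter_map_eq_zero_mul_card (LinearMap.applyₗ x : ((Fin n → F) →ₗ[F] W) →ₗ[F] W).toAddMonoidHom
    fun y => exists_linearMap_apply_eq hx y

/-- Distinct points collide with probability exactly 1/|W|, so off-diagonal pairs cancel against the
squared mean and only the diagonal remains. -/
theorem sum_sum_fiberCount_sub_sq_le (T : Finset (Fin n → F)) :
    ∑ Q : (Fin n → F) →ₗ[F] W, ∑ z, ((fiberCount T Q z : ℝ) - T.card / Fintype.card W) ^ 2 ≤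
      T.card * Fintype.card ((Fin n → F) →ₗ[F] W) := by
  classical
  set k := Fintype.card W with hk
  set H := Fintype.card ((Fin n → F) →ₗ[F] W) with hH
  have hk0 : (0 : ℝ) < k := by exact_mod_cast Fintype.card_pos
  have h1 : ∀ Q : (Fin n → F) →ₗ[F] W,
      ∑ z, ((fiberCount T Q z : ℝ) - T.card / k) ^ 2 =
        (∑ x ∈ T, ∑ x' ∈ T, if Q x = Q x' then (1 : ℝ) else 0) - T.card ^ 2 / k := by
    intro Q
    have h2 : ∑ z, (fiberCount T Q z : ℝ) = T.card := by exact_mod_cast sum_fiberCount T Q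
    have h3 : ∑ z, (fiberCount T Q z : ℝ) ^ 2 =
        ∑ x ∈ T, ∑ x' ∈ T, if Q x = Q x' then (1 : ℝ) else 0 := by
      exact_mod_cast sum_fiberCount_sq T Q
    simp only [sub_sq, Finset.sum_add_distrib, Finset.sum_sub_distrib, h3]
    rw [← Finset.sum_mul, ← Finset.mul_sum, h2, Finset.sum_const, Finset.card_univ, ← hk,
      nsmul_eq_mul]
    field_simp
    ring
  have h4 : ∀ x ∈ T, ∀ x' ∈ T, (∑ Q : (Fin n → F) →ₗ[F] W, if Q x = Q x' then (1 : ℝ) else 0) =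
      (if x = x' then (H : ℝ) - H / k else 0) + H / k := by
    intro x _ x' _
    split_ifs with h
    · subst h; simp [hH]
    · have h5 := card_filter_apply_eq_zero_mul_card (W := W) (sub_ne_zero.2 h)
      rw [zero_add, eq_div_iff hk0.ne', hH, ← h5]
      push_cast
      congr 1
      rw [Finset.sum_boole]
      congr 2
      ext Q
      simp [sub_eq_zero]
  rw [Finset.sum_congr rfl fun Q _ => h1 Q, Finset.sum_sub_distrib, Finset.sum_const,
    Finset.card_univ, nsmul_eq_mul, Finset.sum_comm]
  have h6 : (∑ x ∈ T, ∑ Q : (Fin n → F) →ₗ[F] W, ∑ x' ∈ T, if Q x = Q x' then (1 : ℝ) else 0) =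
      T.card * (H - H / k) + T.card ^ 2 * (H / k) := by
    calc _ = ∑ x ∈ T, ∑ x' ∈ T, ((if x = x' then (H : ℝ) - H / k else 0) + H / k) :=
          Finset.sum_congr rfl fun x hx => by
            rw [Finset.sum_comm]
            exact Finset.sum_congr rfl fun x' hx' => h4 x hx x' hx'
      _ = ∑ x ∈ T, (((H : ℝ) - H / k) + T.card * (H / k)) :=
          Finset.sum_congr rfl fun x hx => by
            rw [Finset.sum_add_distrib, Finset.sum_ite_eq, if_pos hx, Finset.sum_const,
              nsmul_eq_mul]
      _ = _ := by rw [Finset.sum_const, nsmul_eq_mul]; ring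
  rw [h6, ← hH]
  have h7 : (0 : ℝ) ≤ T.card * (H / k) := by positivity
  have h8 : (H : ℝ) * (T.card ^ 2 / k) = T.card ^ 2 * (H / k) := by ring
  linarith

/-- For most linear maps `Q` the fibres of `Q` on `T`, truncated at `C`, are almost full. -/
theorem card_filter_deficit_le (T : Finset (Fin n → F)) (C : ℕ) {h γ : ℝ}
    (hh : h * Fintype.card W = T.card) (hC : (C : ℝ) < h) (hγ : 0 < γ) :
    ((Finset.univ.filter fun Q : (Fin n → F) →ₗ[F] W =>
      γ < ∑ z, ((C : ℝ) - min (fiberCount T Q z : ℝ) C)).card : ℝ) ≤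
      T.card * Fintype.card ((Fin n → F) →ₗ[F] W) / (4 * (h - C) * γ) := by
  classical
  have hk0 : (0 : ℝ) < Fintype.card W := by exact_mod_cast Fintype.card_pos
  have hhC : 0 < h - C := by linarith
  have hh' : (T.card : ℝ) / Fintype.card W = h := by rw [← hh]; field_simp
  -- For `c ≤ C` this is (x + y)^2 ≥ 4xy with x = h - C and y = C - c.
  have hpt : ∀ c : ℝ, (C : ℝ) - min c C ≤ (c - h) ^ 2 / (4 * (h - C)) := by
    intro c
    rw [le_div_iff₀ (by positivity)]
    rcases le_total c C with hc | hc
    · rw [min_eq_left hc]; nlinarith [sq_nonneg (h - c - 2 * (h - C))]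
    · rw [min_eq_right hc]; nlinarith [sq_nonneg (c - h)]
  have hnn : ∀ c : ℝ, 0 ≤ (C : ℝ) - min c C := fun c => sub_nonneg.2 (min_le_right _ _)
  have hsum : ∑ Q : (Fin n → F) →ₗ[F] W, ∑ z, ((C : ℝ) - min (fiberCount T Q z : ℝ) C) ≤
      T.card * Fintype.card ((Fin n → F) →ₗ[F] W) / (4 * (h - C)) := by
    have h1 := sum_sum_fiberCount_sub_sq_le (W := W) T
    rw [hh'] at h1
    calc _ ≤ ∑ Q : (Fin n → F) →ₗ[F] W, ∑ z, ((fiberCount T Q z : ℝ) - h) ^ 2 / (4 * (h - C)) :=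
          Finset.sum_le_sum fun Q _ => Finset.sum_le_sum fun z _ => hpt _
      _ = (∑ Q : (Fin n → F) →ₗ[F] W, ∑ z, ((fiberCount T Q z : ℝ) - h) ^ 2) / (4 * (h - C)) := by
          rw [Finset.sum_div]
          exact Finset.sum_congr rfl fun Q _ => (Finset.sum_div ..).symm
      _ ≤ _ := by gcongr
  rw [← div_div, le_div_iff₀ hγ]
  refine le_trans ?_ hsum
  rw [← nsmul_eq_mul]
  calc _ ≤ ∑ Q ∈ Finset.univ.filter (fun Q : (Fin n → F) →ₗ[F] W =>
        γ < ∑ z, ((C : ℝ) - min (fiberCount T Q z : ℝ) C)),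
          ∑ z, ((C : ℝ) - min (fiberCount T Q z : ℝ) C) :=
        Finset.card_nsmul_le_sum _ _ _ fun Q hQ => (Finset.mem_filter.1 hQ).2.le
    _ ≤ _ := Finset.sum_le_sum_of_subset_of_nonneg (Finset.filter_subset _ _)
        fun Q _ _ => Finset.sum_nonneg fun z _ => hnn _

end RandomMaps

/-! ### Non-surjective maps are rare -/

theorem card_dual_eq {F : Type*} [Field F] [Fintype F] (n : ℕ) [Fintype ((Fin n → F) →ₗ[F] F)] :
    Fintype.card ((Fin n → F) →ₗ[F] F) = Fintype.card F ^ n := by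
  rw [Module.card_eq_pow_finrank (K := F) (V := (Fin n → F) →ₗ[F] F), Module.finrank_linearMap]
  simp

theorem card_filter_comp_eq_zero_mul {F : Type*} [Field F] [Fintype F] {n t : ℕ}
    [Fintype ((Fin n → F) →ₗ[F] (Fin t → F))] [DecidableEq ((Fin n → F) →ₗ[F] F)]
    {f : (Fin t → F) →ₗ[F] F} (hf : f ≠ 0) :
    (Finset.univ.filter fun L : (Fin n → F) →ₗ[F] (Fin t → F) => f.comp L = 0).card *
      Fintype.card F ^ n = Fintype.card ((Fin n → F) →ₗ[F] (Fin t → F)) := by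
  have : Finite ((Fin n → F) →ₗ[F] F) := DFunLike.finite _
  let _ : Fintype ((Fin n → F) →ₗ[F] F) := Fintype.ofFinite _
  let ev : ((Fin n → F) →ₗ[F] (Fin t → F)) →+ ((Fin n → F) →ₗ[F] F) :=
    AddMonoidHom.mk' (fun L => f.comp L) fun L L' => LinearMap.ext fun x => map_add f (L x) (L' x)
  have hsurj : Function.Surjective ev := by
    intro φ
    obtain ⟨y, hy⟩ := not_forall.1 fun h => hf (LinearMap.ext h)
    refine ⟨φ.smulRight ((f y)⁻¹ • y), LinearMap.ext fun x => ?_⟩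
    change f (φ x • (f y)⁻¹ • y) = φ x
    rw [map_smul, map_smul, smul_eq_mul, smul_eq_mul, inv_mul_cancel₀ (by simpa using hy), mul_one]
  rw [← card_dual_eq]
  exact card_filter_map_eq_zero_mul_card ev hsurj

/-- At most a `q ^ (t - n)` fraction of the linear maps `F ^ n → F ^ t` is not surjective. -/
theorem card_filter_not_surjective_mul_le {F : Type*} [Field F] [Fintype F] {n t : ℕ}
    [Fintype ((Fin n → F) →ₗ[F] (Fin t → F))]
    [DecidablePred fun L : (Fin n → F) →ₗ[F] (Fin t → F) => ¬ Function.Surjective L] :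
    (Finset.univ.filter fun L : (Fin n → F) →ₗ[F] (Fin t → F) => ¬ Function.Surjective L).card *
      Fintype.card F ^ n ≤ Fintype.card F ^ t * Fintype.card ((Fin n → F) →ₗ[F] (Fin t → F)) := by
  classical
  have : Finite ((Fin t → F) →ₗ[F] F) := DFunLike.finite _
  let _ : Fintype ((Fin t → F) →ₗ[F] F) := Fintype.ofFinite _
  -- The range of a non-surjective map lies in the kernel of a nonzero functional; the rest is a
  -- union bound over at most `q ^ t` functionals.
  have hcover : (Finset.univ.filter fun L : (Fin n → F) →ₗ[F] (Fin t → F) =>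
      ¬ Function.Surjective L) ⊆
        (Finset.univ.filter fun f : (Fin t → F) →ₗ[F] F => f ≠ 0).biUnion
          fun f => Finset.univ.filter fun L => f.comp L = 0 := by
    intro L hL
    have hL' := (Finset.mem_filter.1 hL).2
    rw [← LinearMap.range_eq_top] at hL'
    obtain ⟨f, hf0, hf⟩ := Submodule.exists_le_ker_of_lt_top _ (lt_top_iff_ne_top.2 hL')
    simp only [Finset.mem_biUnion, Finset.mem_filter, Finset.mem_univ, true_and]
    exact ⟨f, hf0, LinearMap.ext fun x => hf (LinearMap.mem_range_self L x)⟩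
  calc _ ≤ (∑ f ∈ Finset.univ.filter (fun f : (Fin t → F) →ₗ[F] F => f ≠ 0),
        (Finset.univ.filter fun L : (Fin n → F) →ₗ[F] (Fin t → F) => f.comp L = 0).card) *
          Fintype.card F ^ n :=
        Nat.mul_le_mul_right _ ((Finset.card_le_card hcover).trans Finset.card_biUnion_le)
    _ = ∑ f ∈ Finset.univ.filter (fun f : (Fin t → F) →ₗ[F] F => f ≠ 0),
        Fintype.card ((Fin n → F) →ₗ[F] (Fin t → F)) := by
        rw [Finset.sum_mul]
        exact Finset.sum_congr rfl fun f hf =>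
          card_filter_comp_eq_zero_mul (Finset.mem_filter.1 hf).2
    _ ≤ _ := by
        rw [Finset.sum_const, smul_eq_mul, ← card_dual_eq t]
        exact Nat.mul_le_mul_right _ (Finset.card_filter_le _ _)

/-! ### Bad maps make every pair of directions heavy -/

/-- The vectors may be dependent, so their span has dimension at most 2; spare coordinates of a
complement fill it up to `F ^ 2`. -/
theorem exists_linearEquiv_prod {F : Type*} [Field F] {t : ℕ} (v₁ v₂ : Fin (t + 2) → F) :
    ∃ e : (Fin (t + 2) → F) ≃ₗ[F] (Fin t → F) × (Fin 2 → F), (e v₁).1 = 0 ∧ (e v₂).1 = 0 := by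
  classical
  set P := Submodule.span F (({v₁, v₂} : Finset (Fin (t + 2) → F)) : Set (Fin (t + 2) → F)) with hP
  obtain ⟨Q, hQ⟩ := P.exists_isCompl
  have hPQ := Submodule.finrank_add_eq_of_isCompl hQ
  rw [Module.finrank_fin_fun] at hPQ
  have hP2 : Module.finrank F P ≤ 2 :=
    (finrank_span_finset_le_card _).trans (Finset.card_insert_le _ _)
  let eQ : Q ≃ₗ[F] (Fin t → F) × (Fin (Module.finrank F Q - t) → F) :=
    LinearEquiv.ofFinrankEq _ _ (by rw [Module.finrank_prod]; simp; omega)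
  let eP : (P × (Fin (Module.finrank F Q - t) → F)) ≃ₗ[F] (Fin 2 → F) :=
    LinearEquiv.ofFinrankEq _ _ (by rw [Module.finrank_prod]; simp; omega)
  let e₁ : (P × Q) ≃ₗ[F] (Fin t → F) × (Fin 2 → F) :=
    { toFun := fun p => ((eQ p.2).1, eP (p.1, (eQ p.2).2))
      map_add' := fun p p' => by
        simp only [Prod.fst_add, Prod.snd_add, map_add, Prod.mk_add_mk, ← map_add eP]
      map_smul' := fun c p => by
        simp only [Prod.smul_fst, Prod.smul_snd, map_smul, RingHom.id_apply, Prod.smul_mk,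
          ← map_smul eP]
      invFun := fun r => ((eP.symm r.2).1, eQ.symm (r.1, (eP.symm r.2).2))
      left_inv := fun p => by simp
      right_inv := fun r => by simp }
  refine ⟨(Submodule.prodEquivOfIsCompl P Q hQ).symm.trans e₁, ?_⟩
  have key : ∀ v ∈ P, (((Submodule.prodEquivOfIsCompl P Q hQ).symm.trans e₁) v).1 = 0 := by
    intro v hv
    have : (Submodule.prodEquivOfIsCompl P Q hQ).symm v = (⟨v, hv⟩, 0) :=
      Submodule.prodEquivOfIsCompl_symm_apply_left (h := hQ) (x := ⟨v, hv⟩)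
    rw [LinearEquiv.trans_apply, this]
    change (eQ 0).1 = 0
    simp
  exact ⟨key v₁ (Submodule.subset_span (by simp)), key v₂ (Submodule.subset_span (by simp))⟩

/-- Some translate of a subspace spanned by two vectors and containing `v.1` and `v.2` has
`w`-weight at least `B`. -/
def HeavyDirection {F : Type*} [Field F] [Fintype F] {N : ℕ} (w : (Fin N → F) → ℕ) (B : ℝ)
    (v : (Fin N → F) × (Fin N → F)) : Prop :=
  ∃ (k : Fin 2 → Fin N → F) (a : Fin N → F) (s₁ s₂ : Fin 2 → F),
    spanMap k s₁ = v.1 ∧ spanMap k s₂ = v.2 ∧ B ≤ ∑ s, (w (a + spanMap k s) : ℝ)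

theorem HeavyDirection.mono {F : Type*} [Field F] [Fintype F] {N : ℕ} {w w' : (Fin N → F) → ℕ}
    {B : ℝ} {v : (Fin N → F) × (Fin N → F)} (h : HeavyDirection w B v) (hw : ∀ y, w y ≤ w' y) :
    HeavyDirection w' B v := by
  obtain ⟨k, a, s₁, s₂, h1, h2, h3⟩ := h
  exact ⟨k, a, s₁, s₂, h1, h2, h3.trans (Finset.sum_le_sum fun s _ => by exact_mod_cast hw _)⟩

section Covering

variable {F : Type*} [Field F] [Fintype F] {n t : ℕ}

open Classical in
/-- If many linear maps `L` have a large fibre on `S`, then for each pair of vectors `v` a random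
linear map `M` makes `v` a heavy direction of the truncated fibre sizes of `M`. -/
theorem card_mul_card_le_card_filter_heavyDirection
    [Fintype ((Fin n → F) →ₗ[F] (Fin t → F))] [Fintype ((Fin n → F) →ₗ[F] (Fin 2 → F))]
    [Fintype ((Fin n → F) →ₗ[F] (Fin (t + 2) → F))]
    (S : Finset (Fin n → F)) (C : ℕ) {h₀ γ : ℝ} (hC : (C : ℝ) < h₀) (hγ : 0 < γ)
    (Bad : Finset ((Fin n → F) →ₗ[F] (Fin t → F)))
    (hBad : ∀ L ∈ Bad, ∃ y, h₀ * (Fintype.card F : ℝ) ^ 2 ≤ fiberCount S L y)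
    (v : (Fin (t + 2) → F) × (Fin (t + 2) → F)) :
    (Bad.card : ℝ) * (Fintype.card ((Fin n → F) →ₗ[F] (Fin 2 → F)) *
        (1 - h₀ * (Fintype.card F : ℝ) ^ 2 / (4 * (h₀ - C) * γ))) ≤
      (Finset.univ.filter fun M : (Fin n → F) →ₗ[F] (Fin (t + 2) → F) => HeavyDirection
        (fun y => min (fiberCount S M y) C) (C * (Fintype.card F : ℝ) ^ 2 - γ) v).card := by
  set q := Fintype.card F with hq
  have hq0 : (0 : ℝ) < q := by exact_mod_cast Fintype.card_pos
  obtain ⟨e, he₁, he₂⟩ := exists_linearEquiv_prod v.1 v.2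
  let good : ((Fin n → F) →ₗ[F] (Fin t → F)) → Finset ((Fin n → F) →ₗ[F] (Fin 2 → F)) := fun L =>
    Finset.univ.filter fun Q => ∃ y, (C * (q : ℝ) ^ 2 - γ) ≤
      ∑ z, (min (fiberCount (S.filter fun x => L x = y) Q z) C : ℝ)
  have hgood : ∀ L ∈ Bad, (Fintype.card ((Fin n → F) →ₗ[F] (Fin 2 → F)) : ℝ) *
      (1 - h₀ * (q : ℝ) ^ 2 / (4 * (h₀ - C) * γ)) ≤ (good L).card := by
    intro L hL
    obtain ⟨y, hy⟩ := hBad L hL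
    set T := S.filter fun x => L x = y with hT
    have hTc : fiberCount S L y = T.card := rfl
    rw [hTc] at hy
    set h := (T.card : ℝ) / q ^ 2 with hh
    have hW : (Fintype.card (Fin 2 → F) : ℝ) = q ^ 2 := by simp [hq]
    have hhh : h * q ^ 2 = T.card := by rw [hh]; field_simp
    have hh₀ : h₀ ≤ h := by rw [hh, le_div_iff₀ (by positivity)]; exact hy
    have h1 := card_filter_deficit_le (W := Fin 2 → F) T C (by rw [hW]; exact hhh)
      (hC.trans_le hh₀) hγ
    have h2 : (Finset.univ.filter fun Q : (Fin n → F) →ₗ[F] (Fin 2 → F) =>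
        ¬ γ < ∑ z, ((C : ℝ) - min (fiberCount T Q z : ℝ) C)) ⊆ good L := by
      intro Q hQ
      have := (Finset.mem_filter.1 hQ).2
      rw [not_lt, Finset.sum_sub_distrib, Finset.sum_const, Finset.card_univ, nsmul_eq_mul, hW]
        at this
      refine Finset.mem_filter.2 ⟨Finset.mem_univ _, y, ?_⟩
      linarith
    have h3 := Finset.card_filter_add_card_filter_not (s := Finset.univ)
      (fun Q : (Fin n → F) →ₗ[F] (Fin 2 → F) =>
        γ < ∑ z, ((C : ℝ) - min (fiberCount T Q z : ℝ) C))
    have h4 := Finset.card_le_card h2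
    rw [Finset.card_univ] at h3
    have h3' : ((Finset.univ.filter fun Q : (Fin n → F) →ₗ[F] (Fin 2 → F) =>
        γ < ∑ z, ((C : ℝ) - min (fiberCount T Q z : ℝ) C)).card : ℝ) +
        (Finset.univ.filter fun Q : (Fin n → F) →ₗ[F] (Fin 2 → F) =>
        ¬ γ < ∑ z, ((C : ℝ) - min (fiberCount T Q z : ℝ) C)).card =
        Fintype.card ((Fin n → F) →ₗ[F] (Fin 2 → F)) := by exact_mod_cast h3
    have h4' : ((Finset.univ.filter fun Q : (Fin n → F) →ₗ[F] (Fin 2 → F) =>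
        ¬ γ < ∑ z, ((C : ℝ) - min (fiberCount T Q z : ℝ) C)).card : ℝ) ≤ (good L).card := by
      exact_mod_cast h4
    have hpos : 0 < h₀ - C := by linarith
    have hpos' : 0 < h - C := by linarith
    -- h / (h - C) decreases in h, so the smallest admissible fibre is the worst case.
    have h5 : h * (q : ℝ) ^ 2 / (4 * (h - C) * γ) ≤ h₀ * (q : ℝ) ^ 2 / (4 * (h₀ - C) * γ) := by
      rw [div_le_div_iff₀ (by positivity) (by positivity)]
      have : (0 : ℝ) ≤ C := Nat.cast_nonneg C
      have h6 : h * (h₀ - C) ≤ h₀ * (h - C) := by nlinarith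
      have h7 : (0 : ℝ) ≤ q ^ 2 * 4 * γ := by positivity
      nlinarith [mul_le_mul_of_nonneg_left h6 h7]
    have h8 : (T.card : ℝ) * Fintype.card ((Fin n → F) →ₗ[F] (Fin 2 → F)) / (4 * (h - C) * γ) ≤
        Fintype.card ((Fin n → F) →ₗ[F] (Fin 2 → F)) *
          (h₀ * (q : ℝ) ^ 2 / (4 * (h₀ - C) * γ)) := by
      calc _ = Fintype.card ((Fin n → F) →ₗ[F] (Fin 2 → F)) *
          (h * (q : ℝ) ^ 2 / (4 * (h - C) * γ)) := by rw [hhh]; ring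
        _ ≤ _ := mul_le_mul_of_nonneg_left h5 (Nat.cast_nonneg _)
    linarith
  -- The splitting `e` depends on `v`, but for each `v` distinct pairs (L, Q) give distinct maps, so
  -- counting pairs bounds the number of maps from below.
  let pack : (Σ _ : (Fin n → F) →ₗ[F] (Fin t → F), (Fin n → F) →ₗ[F] (Fin 2 → F)) →
      ((Fin n → F) →ₗ[F] (Fin (t + 2) → F)) := fun p =>
    (e.symm : (Fin t → F) × (Fin 2 → F) →ₗ[F] (Fin (t + 2) → F)).comp (p.1.prod p.2)
  have hpack : ∀ p x, pack p x = e.symm (p.1 x, p.2 x) := fun p x => rfl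
  have hinj : Function.Injective pack := by
    rintro ⟨L, Q⟩ ⟨L', Q'⟩ h
    have h' : ∀ x, (L x, Q x) = (L' x, Q' x) := fun x =>
      e.symm.injective (by simpa only [hpack] using DFunLike.congr_fun h x)
    have hL : L = L' := LinearMap.ext fun x => congrArg Prod.fst (h' x)
    have hQ : Q = Q' := LinearMap.ext fun x => congrArg Prod.snd (h' x)
    rw [hL, hQ]
  have hmem : ∀ p ∈ Bad.sigma good, HeavyDirection
      (fun y => min (fiberCount S (pack p) y) C) (C * (q : ℝ) ^ 2 - γ) v := by
    rintro ⟨L, Q⟩ hp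
    obtain ⟨-, hQ⟩ := Finset.mem_sigma.1 hp
    obtain ⟨y, hy⟩ := (Finset.mem_filter.1 hQ).2
    let k : Fin 2 → Fin (t + 2) → F := fun b => e.symm (0, Pi.single b 1)
    have hk : ∀ s, spanMap k s = e.symm (0, s) := by
      intro s
      have h1 : spanMap k s = ∑ b, s b • k b := by
        funext j; simp [spanMap]
      have h2 : ((0, s) : (Fin t → F) × (Fin 2 → F)) =
          ∑ b, s b • ((0, Pi.single b 1) : (Fin t → F) × (Fin 2 → F)) := by
        rw [Fin.sum_univ_two]
        refine Prod.ext (by simp) (funext fun j => ?_)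
        fin_cases j <;> simp
      rw [h1, h2, map_sum]
      exact Finset.sum_congr rfl fun b _ => (map_smul e.symm _ _).symm
    refine ⟨k, e.symm (y, 0), (e v.1).2, (e v.2).2, ?_, ?_, ?_⟩
    · rw [hk, ← he₁]; exact e.symm_apply_apply _
    · rw [hk, ← he₂]; exact e.symm_apply_apply _
    · refine hy.trans (le_of_eq (Finset.sum_congr rfl fun s _ => ?_))
      have : fiberCount (S.filter fun x => L x = y) Q s =
          fiberCount S (pack ⟨L, Q⟩) (e.symm (y, 0) + spanMap k s) := by
        rw [hk, ← map_add, fiberCount, fiberCount, Finset.filter_filter]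
        congr 1
        refine Finset.filter_congr fun x _ => ?_
        rw [hpack, e.symm.injective.eq_iff]
        simp [Prod.ext_iff]
      rw [this]
      push_cast
      rfl
  refine le_trans (b := ((Bad.sigma good).card : ℝ)) ?_ (Nat.cast_le.2 ?_)
  · rw [Finset.card_sigma, Nat.cast_sum, ← nsmul_eq_mul]
    exact Finset.card_nsmul_le_sum _ _ _ hgood
  · rw [← Finset.card_image_of_injective _ hinj]
    refine Finset.card_le_card fun M hM => ?_
    obtain ⟨p, hp, rfl⟩ := Finset.mem_image.1 hM
    exact Finset.mem_filter.2 ⟨Finset.mem_univ _, hmem p hp⟩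

end Covering

open Classical in
/-- If every `x` is related to at least a fraction `δ` of all `y`, then some `j` elements `y` leave
at most a fraction `(1 - δ) ^ j` of all `x` uncovered. -/
theorem exists_cover {X Y : Type*} [Fintype X] [Fintype Y] [Nonempty Y] (R : Y → X → Prop)
    {δ : ℝ}
    (hR : ∀ x, δ * Fintype.card Y ≤ (Finset.univ.filter fun y => R y x).card) (hδ : δ ≤ 1)
    (j : ℕ) : ∃ A : Fin j → Y, ∃ U : Finset X, (∀ x ∉ U, ∃ i, R (A i) x) ∧
      (U.card : ℝ) ≤ (1 - δ) ^ j * Fintype.card X := by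
  induction j with
  | zero => exact ⟨Fin.elim0, Finset.univ, fun x hx => absurd (Finset.mem_univ x) hx, by simp⟩
  | succ j ih =>
    obtain ⟨A, U, hU, hUc⟩ := ih
    -- Averaging over `y`: some `y` covers at least the mean proportion of what is still uncovered.
    obtain ⟨y, hy⟩ : ∃ y, δ * U.card ≤ ((U.filter fun x => R y x).card : ℝ) := by
      by_contra hcon
      push Not at hcon
      have h1 : ∑ y, ((U.filter fun x => R y x).card : ℝ) < ∑ _y : Y, δ * U.card :=
        Finset.sum_lt_sum_of_nonempty Finset.univ_nonempty fun y _ => hcon y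
      have h2 : ∑ y, ((U.filter fun x => R y x).card : ℝ) =
          ∑ x ∈ U, ((Finset.univ.filter fun y => R y x).card : ℝ) := by
        simp only [Finset.card_filter, Nat.cast_sum]
        exact Finset.sum_comm
      have h3 : ∑ _x ∈ U, δ * Fintype.card Y ≤
          ∑ x ∈ U, ((Finset.univ.filter fun y => R y x).card : ℝ) :=
        Finset.sum_le_sum fun x _ => hR x
      rw [h2] at h1
      rw [Finset.sum_const, nsmul_eq_mul] at h3
      rw [Finset.sum_const, nsmul_eq_mul, Finset.card_univ] at h1
      linarith
    refine ⟨Fin.snoc A y, U.filter fun x => ¬ R y x, fun x hx => ?_, ?_⟩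
    · by_cases hxU : x ∈ U
      · refine ⟨Fin.last j, ?_⟩
        rw [Fin.snoc_last]
        by_contra hn
        exact hx (Finset.mem_filter.2 ⟨hxU, hn⟩)
      · obtain ⟨i, hi⟩ := hU x hxU
        exact ⟨i.castSucc, by rwa [Fin.snoc_castSucc]⟩
    · have h4 : ((U.filter fun x => R y x).card : ℝ) + (U.filter fun x => ¬ R y x).card = U.card := by
        exact_mod_cast Finset.card_filter_add_card_filter_not (s := U) (fun x => R y x)
      calc ((U.filter fun x => ¬ R y x).card : ℝ) ≤ (1 - δ) * U.card := by linarith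
        _ ≤ (1 - δ) * ((1 - δ) ^ j * Fintype.card X) :=
          mul_le_mul_of_nonneg_left hUc (by linarith)
        _ = _ := by ring

/-! ### Numerical choice of the number of maps -/

theorem exp_neg_ge_of_le {x : ℝ} (hx : x ≤ 1.583) : 0.2 ≤ Real.exp (-x) := by
  have h1 : (0.2 : ℝ) ≤ (1 - 1.583 / (100 : ℕ)) ^ 100 := by norm_num
  have h2 := Real.one_sub_div_pow_le_exp_neg (n := 100) (t := 1.583) (by norm_num)
  exact h1.trans (h2.trans (Real.exp_le_exp.2 (by linarith)))

theorem one_sub_exp_neg_ge {x : ℝ} (h0 : 0 ≤ x) (h1 : x ≤ 1) : 0.632 * x ≤ 1 - Real.exp (-x) := by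
  have h := convexOn_exp.2 (Set.mem_univ 0) (Set.mem_univ (-1)) (sub_nonneg.2 h1) h0
    (by ring)
  simp only [smul_eq_mul, mul_zero, zero_add, mul_neg, mul_one, Real.exp_zero] at h
  have h2 := Real.exp_neg_one_lt_d9
  nlinarith

/-- The numerical inequality behind the choice of the number `j` of random maps. -/
theorem exists_number_of_maps {p δ A : ℝ} (hp : 0 < p) (hδ : 0 < δ) (hδ' : δ < 1 / 10)
    (hA1 : A ≤ 1) (hA : A ≤ δ ^ 2 * p ^ 2) :
    ∃ j : ℕ, 0 < 1 - (1 - 0.79 * δ) ^ j ∧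
      (j : ℝ) < 0.674 * (2 + 2 * p + p ^ 2) * Real.exp (-(A / (1 - (1 - 0.79 * δ) ^ j))) := by
  -- For small `p` a single map suffices. Here 0.1266 exceeds 0.1/0.79, using δ < 1/10, and 0.32916
  -- = 0.1266 · 2.6.
  rcases le_or_gt p 2.6 with hp' | hp'
  · refine ⟨1, by rw [pow_one]; linarith, ?_⟩
    have e : 1 - (1 - 0.79 * δ) ^ 1 = 0.79 * δ := by ring
    rw [e]
    have h1 : A / (0.79 * δ) ≤ 0.1266 * p ^ 2 := by
      rw [div_le_iff₀ (by positivity)]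
      nlinarith [mul_pos hδ (pow_pos hp 2)]
    have h2 : 1 - 0.1266 * p ^ 2 ≤ Real.exp (-(A / (0.79 * δ))) := by
      have := Real.one_sub_le_exp_neg (A / (0.79 * δ))
      linarith
    have h3 : p ^ 2 ≤ 2.6 * p := by nlinarith
    have h4 : 2 ≤ (2 + 2 * p + p ^ 2) * (1 - 0.1266 * p ^ 2) := by
      have h5 : p ^ 3 ≤ 2.6 * p ^ 2 := by nlinarith [pow_pos hp 2]
      have h6 : (2 + 2 * p + p ^ 2) * (1 - 0.32916 * p) ≤
          (2 + 2 * p + p ^ 2) * (1 - 0.1266 * p ^ 2) :=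
        mul_le_mul_of_nonneg_left (by linarith) (by positivity)
      nlinarith
    have h7 : (2 + 2 * p + p ^ 2) * (1 - 0.1266 * p ^ 2) ≤
        (2 + 2 * p + p ^ 2) * Real.exp (-(A / (0.79 * δ))) :=
      mul_le_mul_of_nonneg_left h2 (by positivity)
    push_cast
    linarith
  · set δ' := 0.79 * δ with hδ'def
    have hδ'0 : 0 < δ' := by positivity
    set a := min 1 (δ ^ 2 * p ^ 2) with ha
    have ha0 : 0 < a := lt_min one_pos (by positivity)
    have ha1 : a ≤ 1 := min_le_left _ _
    have haA : A ≤ a := le_min hA1 hA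
    -- This makes the covered fraction at least 1 - exp(-a) ≥ 0.632 a, so the exponent is at most
    -- 1/0.632 < 1.583 and the exponential at least 0.2. The cost j < 0.1266 p^2 + 1 is affordable
    -- as 0.674 · 0.2 > 0.1266.
    set j := ⌈a / δ'⌉₊ with hj
    have hj1 : a ≤ δ' * j := by
      have := Nat.le_ceil (a / δ')
      rwa [div_le_iff₀ hδ'0, mul_comm] at this
    have hj2 : (j : ℝ) < a / δ' + 1 := Nat.ceil_lt_add_one (by positivity)
    have hpow : (1 - δ') ^ j ≤ Real.exp (-a) := by
      calc (1 - δ') ^ j ≤ Real.exp (-δ') ^ j :=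
            pow_le_pow_left₀ (by linarith) (Real.one_sub_le_exp_neg δ') _
        _ = Real.exp (-(δ' * j)) := by rw [← Real.exp_nat_mul]; congr 1; ring
        _ ≤ _ := Real.exp_le_exp.2 (by linarith)
    have hρ : 0.632 * a ≤ 1 - (1 - δ') ^ j := by
      have := one_sub_exp_neg_ge ha0.le ha1
      linarith
    have hρ0 : 0 < 1 - (1 - δ') ^ j := lt_of_lt_of_le (by positivity) hρ
    refine ⟨j, hρ0, ?_⟩
    have h1 : A / (1 - (1 - δ') ^ j) ≤ 1.583 := by
      rw [div_le_iff₀ hρ0]; nlinarith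
    have h2 := exp_neg_ge_of_le h1
    have h3 : a / δ' ≤ 0.1266 * p ^ 2 := by
      rw [div_le_iff₀ hδ'0]
      have : a ≤ δ ^ 2 * p ^ 2 := min_le_right _ _
      nlinarith [mul_pos hδ (pow_pos hp 2)]
    have h4 : 0.674 * (2 + 2 * p + p ^ 2) * 0.2 ≤
        0.674 * (2 + 2 * p + p ^ 2) * Real.exp (-(A / (1 - (1 - δ') ^ j))) :=
      mul_le_mul_of_nonneg_left h2 (by positivity)
    nlinarith

/-! ### Combining covering and the Kakeya bound -/

theorem card_linearMap_eq {F : Type*} [Field F] [Fintype F] (n b : ℕ)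
    [Fintype ((Fin n → F) →ₗ[F] (Fin b → F))] :
    Fintype.card ((Fin n → F) →ₗ[F] (Fin b → F)) = Fintype.card F ^ (n * b) := by
  rw [Module.card_eq_pow_finrank (K := F) (V := (Fin n → F) →ₗ[F] (Fin b → F)),
    Module.finrank_linearMap]
  simp

open Classical in
/-- If a `δ'` fraction of the linear maps `F ^ n → F ^ t` has a fibre on `S` that is larger than
`h₀ q ^ 2`, then `S` is large. -/
theorem lower_bound_of_large_fibers {F : Type*} [Field F] [Fintype F] {n t : ℕ}
    [Fintype ((Fin n → F) →ₗ[F] (Fin t → F))]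
    (S : Finset (Fin n → F)) (C j : ℕ) {h₀ ε δ δ' : ℝ} (hC0 : 0 < C) (hC : (C : ℝ) < h₀)
    (hε : 0 < ε) (hε1 : ε < 1)
    (Bad : Finset ((Fin n → F) →ₗ[F] (Fin t → F)))
    (hBad : ∀ L ∈ Bad, ∃ y, h₀ * (Fintype.card F : ℝ) ^ 2 ≤ fiberCount S L y)
    (hδ : δ * Fintype.card ((Fin n → F) →ₗ[F] (Fin t → F)) ≤ Bad.card)
    (hδ' : δ' ≤ δ * (1 - h₀ / (4 * (h₀ - C) * (ε * C)))) (hδ'1 : δ' ≤ 1)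
    (hmarkov : 0 ≤ 1 - h₀ / (4 * (h₀ - C) * (ε * C)))
    (hρ : 0 < 1 - (1 - δ') ^ j) :
    ((1 - ε) / (1 + 1 / ((1 - (1 - δ') ^ j) * Fintype.card F))) ^ (t + 2) ≤
      (j * S.card : ℕ) / (C * (Fintype.card F : ℝ) ^ (t + 2)) := by
  set q := Fintype.card F with hq
  have hq0 : (0 : ℝ) < q := by exact_mod_cast Fintype.card_pos
  have hfin2 : Finite ((Fin n → F) →ₗ[F] (Fin 2 → F)) := DFunLike.finite _
  have hfinN : Finite ((Fin n → F) →ₗ[F] (Fin (t + 2) → F)) := DFunLike.finite _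
  let _ : Fintype ((Fin n → F) →ₗ[F] (Fin 2 → F)) := Fintype.ofFinite _
  let _ : Fintype ((Fin n → F) →ₗ[F] (Fin (t + 2) → F)) := Fintype.ofFinite _
  have hC0' : (0 : ℝ) < C := by exact_mod_cast hC0
  have hγ : 0 < ε * C * (q : ℝ) ^ 2 := by positivity
  have hcards : (Fintype.card ((Fin n → F) →ₗ[F] (Fin (t + 2) → F)) : ℝ) =
      Fintype.card ((Fin n → F) →ₗ[F] (Fin t → F)) *
        Fintype.card ((Fin n → F) →ₗ[F] (Fin 2 → F)) := by
    rw [card_linearMap_eq, card_linearMap_eq, card_linearMap_eq]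
    push_cast
    ring
  have hR : ∀ v : (Fin (t + 2) → F) × (Fin (t + 2) → F),
      δ' * Fintype.card ((Fin n → F) →ₗ[F] (Fin (t + 2) → F)) ≤
        (Finset.univ.filter fun M : (Fin n → F) →ₗ[F] (Fin (t + 2) → F) => HeavyDirection
          (fun y => min (fiberCount S M y) C) (C * (q : ℝ) ^ 2 - ε * C * (q : ℝ) ^ 2) v).card := by
    intro v
    refine le_trans ?_ (card_mul_card_le_card_filter_heavyDirection S C hC hγ Bad hBad v)
    rw [← hq]
    have e1 : h₀ * (q : ℝ) ^ 2 / (4 * (h₀ - C) * (ε * C * (q : ℝ) ^ 2)) =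
        h₀ / (4 * (h₀ - C) * (ε * C)) := by
      rw [← mul_assoc, mul_div_mul_right _ _ (by positivity)]
    rw [e1, hcards]
    set x := 1 - h₀ / (4 * (h₀ - C) * (ε * C)) with hx
    set a := (Fintype.card ((Fin n → F) →ₗ[F] (Fin t → F)) : ℝ)
    set b := (Fintype.card ((Fin n → F) →ₗ[F] (Fin 2 → F)) : ℝ)
    have ha : 0 ≤ a := Nat.cast_nonneg _
    have hb : 0 ≤ b := Nat.cast_nonneg _
    calc δ' * (a * b) ≤ δ * x * (a * b) := mul_le_mul_of_nonneg_right hδ' (by positivity)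
      _ = (δ * a) * (b * x) := by ring
      _ ≤ _ := mul_le_mul_of_nonneg_right hδ (by positivity)
  obtain ⟨A, U, hU, hUc⟩ := exists_cover (fun (M : (Fin n → F) →ₗ[F] (Fin (t + 2) → F)) v =>
    HeavyDirection (fun y => min (fiberCount S M y) C)
      (C * (q : ℝ) ^ 2 - ε * C * (q : ℝ) ^ 2) v) hR hδ'1 j
  have hX : (Fintype.card ((Fin (t + 2) → F) × (Fin (t + 2) → F)) : ℝ) =
      ((q : ℝ) ^ 2) ^ (t + 2) := by
    rw [Fintype.card_prod, Fintype.card_fun, Fintype.card_fin]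
    push_cast
    rw [← hq]; ring
  rw [hX] at hUc
  -- The fibre counts are truncated after summing over the maps: the cap stays `C`, the total is at
  -- most `j * S.card`, and each single truncated count is still dominated.
  refine weighted_kakeya_bound (fun y => min (∑ i, fiberCount S (A i) y) C) hC0
    (fun y => min_le_right _ _) (W := j * S.card) ?_ (sub_pos.2 hε1) hρ Uᶜ ?_ ?_
  · calc ∑ y, min (∑ i, fiberCount S (A i) y) C ≤ ∑ y, ∑ i, fiberCount S (A i) y :=
          Finset.sum_le_sum fun y _ => min_le_left _ _
      _ = ∑ i, ∑ y, fiberCount S (A i) y := Finset.sum_comm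
      _ = j * S.card := by simp [sum_fiberCount]
  · intro v hv
    obtain ⟨i, hi⟩ := hU v (Finset.mem_compl.1 hv)
    have := hi.mono (w' := fun y => min (∑ i, fiberCount S (A i) y) C) fun y =>
      min_le_min_right _ (Finset.single_le_sum (f := fun i => fiberCount S (A i) y)
        (fun _ _ => Nat.zero_le _) (Finset.mem_univ i))
    obtain ⟨k, a, s₁, s₂, h1, h2, h3⟩ := this
    refine ⟨k, a, s₁, s₂, h1, h2, le_trans (le_of_eq ?_) h3⟩
    rw [← hq]; ring
  · have h1 : ((U.card : ℝ)) + Uᶜ.card = ((q : ℝ) ^ 2) ^ (t + 2) := by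
      rw [← hX]; exact_mod_cast Finset.card_add_card_compl U
    rw [← hq]
    linarith

open Classical in
theorem card_surjective_ge {F : Type*} [Field F] [Fintype F] {n t : ℕ}
    [Fintype ((Fin n → F) →ₗ[F] (Fin t → F))] (hq20 : 20 ≤ (Fintype.card F : ℝ))
    (htn : t + 4 ≤ n) :
    0.99 * (Fintype.card ((Fin n → F) →ₗ[F] (Fin t → F)) : ℝ) ≤
      (Finset.univ.filter fun L : (Fin n → F) →ₗ[F] (Fin t → F) =>
        Function.Surjective L).card := by
  set q := Fintype.card F with hq
  have hq0 : (0 : ℝ) < q := by linarith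
  have h1 := card_filter_not_surjective_mul_le (F := F) (n := n) (t := t)
  have h2 := Finset.card_filter_add_card_filter_not (s := Finset.univ)
    (fun L : (Fin n → F) →ₗ[F] (Fin t → F) => Function.Surjective L)
  rw [Finset.card_univ] at h2
  have h1' : ((Finset.univ.filter fun L : (Fin n → F) →ₗ[F] (Fin t → F) =>
      ¬ Function.Surjective L).card : ℝ) * (q : ℝ) ^ n ≤
        (q : ℝ) ^ t * Fintype.card ((Fin n → F) →ₗ[F] (Fin t → F)) := by exact_mod_cast h1
  have h2' : ((Finset.univ.filter fun L : (Fin n → F) →ₗ[F] (Fin t → F) =>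
      Function.Surjective L).card : ℝ) +
        (Finset.univ.filter fun L : (Fin n → F) →ₗ[F] (Fin t → F) =>
          ¬ Function.Surjective L).card =
        Fintype.card ((Fin n → F) →ₗ[F] (Fin t → F)) := by exact_mod_cast h2
  set x := ((Finset.univ.filter fun L : (Fin n → F) →ₗ[F] (Fin t → F) =>
      ¬ Function.Surjective L).card : ℝ) with hx
  have hx0 : 0 ≤ x := Nat.cast_nonneg _
  have h3 : (q : ℝ) ^ t * 100 ≤ (q : ℝ) ^ n := by
    calc (q : ℝ) ^ t * 100 ≤ (q : ℝ) ^ t * q ^ 4 := by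
          refine mul_le_mul_of_nonneg_left ?_ (by positivity)
          calc (100 : ℝ) ≤ 20 ^ 4 := by norm_num
            _ ≤ (q : ℝ) ^ 4 := pow_le_pow_left₀ (by norm_num) hq20 4
      _ = (q : ℝ) ^ (t + 4) := (pow_add _ _ _).symm
      _ ≤ _ := pow_le_pow_right₀ (by linarith) htn
  have h4 : (q : ℝ) ^ t * (x * 100) ≤
      (q : ℝ) ^ t * Fintype.card ((Fin n → F) →ₗ[F] (Fin t → F)) := by
    refine le_trans ?_ h1'
    calc (q : ℝ) ^ t * (x * 100) = x * ((q : ℝ) ^ t * 100) := by ring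
      _ ≤ _ := mul_le_mul_of_nonneg_left h3 hx0
  have h5 := le_of_mul_le_mul_left h4 (by positivity)
  linarith

/-- With T = 1 + τ, the bound n ≤ 0.01 T μ gives Nε ≤ 0.069, and Bernoulli's inequality leaves the
factor 0.931. Since C ≥ 0.725 T μ, `key` forces j ≥ 0.931 · 0.725 · T · exp(-n/(qρ)), and 0.931 ·
0.725 > 0.674. -/
theorem kakeya_parameters_contradiction {N : ℕ} {j n q T p δ ρ μ C ε : ℝ} (hδ : 0 < δ)
    (hδ' : δ < 1 / 10) (hp : 0 < p) (hT : T = 2 + 2 * p + p ^ 2) (hq : 20 ≤ q)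
    (hap : n / q ≤ δ ^ 2 * p ^ 2) (hρ : 0 < ρ) (hN : (N : ℝ) ≤ n) (hμ : q ≤ μ)
    (hC : 0.725 * (T * μ) ≤ C) (hε : ε * (T * μ) = 200 / 29) (hε0 : 0 < ε) (hε1 : ε < 1)
    (hj : j < 0.674 * T * Real.exp (-(n / q / ρ))) (hj0 : 0 ≤ j)
    (key : ((1 - ε) / (1 + 1 / (ρ * q))) ^ N ≤ j * (μ / C)) : False := by
  have hq0 : 0 < q := by linarith
  have hμ0 : 0 < μ := by linarith
  have hT2 : 2 < T := by nlinarith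
  have hC0 : 0 < C := lt_of_lt_of_le (by positivity) hC
  have h1 : 1 - N * ε ≤ (1 - ε) ^ N := by
    have := one_add_mul_le_pow (a := -ε) (by linarith) N
    calc _ = 1 + (N : ℝ) * -ε := by ring
      _ ≤ (1 + -ε) ^ N := this
      _ = _ := by rw [← sub_eq_add_neg]
  have h2 : (N : ℝ) * ε ≤ 0.069 := by
    have h3 : n / q ≤ 0.01 * T := by
      have h4 : δ ^ 2 ≤ 0.01 := by nlinarith
      have h5 : δ ^ 2 * p ^ 2 ≤ 0.01 * p ^ 2 := mul_le_mul_of_nonneg_right h4 (sq_nonneg p)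
      linarith
    have h6 : n ≤ 0.01 * (T * μ) := by
      rw [div_le_iff₀ hq0] at h3
      calc n ≤ 0.01 * T * q := h3
        _ ≤ 0.01 * T * μ := mul_le_mul_of_nonneg_left hμ (by positivity)
        _ = _ := by ring
    calc (N : ℝ) * ε ≤ (0.01 * (T * μ)) * ε := mul_le_mul_of_nonneg_right (hN.trans h6) hε0.le
      _ = 0.01 * (ε * (T * μ)) := by ring
      _ ≤ 0.069 := by rw [hε]; norm_num
  have h6 : (1 + 1 / (ρ * q)) ^ N ≤ Real.exp (n / q / ρ) := by
    calc (1 + 1 / (ρ * q)) ^ N ≤ Real.exp (1 / (ρ * q)) ^ N := by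
          refine pow_le_pow_left₀ (by positivity) ?_ _
          rw [add_comm]; exact Real.add_one_le_exp _
      _ = Real.exp (N * (1 / (ρ * q))) := (Real.exp_nat_mul _ _).symm
      _ ≤ Real.exp (n / q / ρ) := by
          refine Real.exp_le_exp.2 ?_
          calc (N : ℝ) * (1 / (ρ * q)) ≤ n * (1 / (ρ * q)) :=
                mul_le_mul_of_nonneg_right hN (by positivity)
            _ = n / q / ρ := by field_simp
  have h7 : 0.931 * Real.exp (-(n / q / ρ)) ≤ ((1 - ε) / (1 + 1 / (ρ * q))) ^ N := by
    rw [div_pow, le_div_iff₀ (by positivity), Real.exp_neg, mul_assoc]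
    have h8 : (Real.exp (n / q / ρ))⁻¹ * (1 + 1 / (ρ * q)) ^ N ≤ 1 := by
      rw [inv_mul_le_iff₀ (Real.exp_pos _), mul_one]; exact h6
    linarith
  have h9 : j * (μ / C) * (0.725 * T) ≤ j := by
    rw [mul_assoc]
    refine mul_le_of_le_one_right hj0 ?_
    rw [div_mul_eq_mul_div, div_le_one hC0]
    calc μ * (0.725 * T) = 0.725 * (T * μ) := by ring
      _ ≤ C := hC
  have h10 : 0.931 * Real.exp (-(n / q / ρ)) * (0.725 * T) ≤ j :=
    (mul_le_mul_of_nonneg_right (h7.trans key) (by linarith)).trans h9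
  have h11 : 0 < T * Real.exp (-(n / q / ρ)) := mul_pos (by linarith) (Real.exp_pos _)
  linarith

open Classical in
/-- At most a fraction `δ` of the surjective linear maps has a fibre on `S` that is larger than
`1 + τ` times the average. -/
theorem card_large_fibers_le {F : Type*} [Field F] [Fintype F] {n t : ℕ}
    [Fintype ((Fin n → F) →ₗ[F] (Fin t → F))] (hn : 20 ≤ n) (htn : t + 4 ≤ n)
    (S : Finset (Fin n → F)) {τ δ : ℝ} (hτ : 1 < τ) (hδ : 0 < δ) (hδ' : δ < 1 / 10)
    (hq₁ : (n : ℝ) * ((1 + τ) / ((τ - Real.sqrt τ) ^ 2 * δ ^ 2)) ≤ Fintype.card F)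
    (hq₂ : (n : ℝ) ≤ Fintype.card F) (hS : Fintype.card F ^ (t + 3) < S.card) :
    ((Finset.univ.filter fun L : (Fin n → F) →ₗ[F] (Fin t → F) => Function.Surjective L ∧
        ∃ y, (1 + τ) * S.card / (Fintype.card F : ℝ) ^ t < fiberCount S L y).card : ℝ) ≤
      δ * (Finset.univ.filter fun L : (Fin n → F) →ₗ[F] (Fin t → F) =>
        Function.Surjective L).card := by
  set q := Fintype.card F with hq
  set Bad := Finset.univ.filter fun L : (Fin n → F) →ₗ[F] (Fin t → F) => Function.Surjective L ∧
        ∃ y, (1 + τ) * S.card / (q : ℝ) ^ t < fiberCount S L y with hBad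
  by_contra hcon
  rw [not_le] at hcon
  have hn' : (20 : ℝ) ≤ n := by exact_mod_cast hn
  have hq20 : (20 : ℝ) ≤ q := hn'.trans hq₂
  have hq0 : (0 : ℝ) < q := by linarith
  have hS' : (q : ℝ) ^ (t + 3) < S.card := by exact_mod_cast hS
  have hsurj := card_surjective_ge (n := n) (t := t) hq20 htn
  set s := Real.sqrt τ with hs
  have hs2 : s ^ 2 = τ := Real.sq_sqrt (by linarith)
  have hs1 : 1 < s := Real.lt_sqrt_of_sq_lt (by linarith)
  set p := s - 1 with hp
  have hp0 : 0 < p := by linarith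
  have hτp : 1 + τ = 2 + 2 * p + p ^ 2 := by rw [← hs2, hp]; ring
  set a := (n : ℝ) / q with ha
  have ha1 : a ≤ 1 := (div_le_one hq0).2 hq₂
  -- Here τ - √τ = √τ · p, and the leftover factor τ / (1 + τ) is at most 1.
  have hap : a ≤ δ ^ 2 * p ^ 2 := by
    have h1 : (τ - s) ^ 2 = τ * p ^ 2 := by rw [← hs2, hp]; ring
    have h2 : 0 < τ * p ^ 2 * δ ^ 2 := by positivity
    rw [h1, ← mul_div_assoc, div_le_iff₀ h2] at hq₁
    rw [ha, div_le_iff₀ hq0]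
    have h3 : 0 ≤ (n : ℝ) := Nat.cast_nonneg _
    have h4 : (1 + τ) * n ≤ (1 + τ) * (δ ^ 2 * p ^ 2 * q) := by
      have : 0 ≤ δ ^ 2 * p ^ 2 * q := by positivity
      nlinarith
    exact le_of_mul_le_mul_left h4 (by linarith)
  obtain ⟨j, hρ, hj⟩ := exists_number_of_maps hp0 hδ hδ' ha1 hap
  set ρ := 1 - (1 - 0.79 * δ) ^ j with hρdef
  set μ := (S.card : ℝ) / (q : ℝ) ^ (t + 2) with hμ
  have hμq : (q : ℝ) ≤ μ := by
    rw [hμ, le_div_iff₀ (by positivity)]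
    calc (q : ℝ) * q ^ (t + 2) = q ^ (t + 3) := by ring
      _ ≤ _ := hS'.le
  have hμ0 : 0 < μ := hq0.trans_le hμq
  set h₀ := (1 + τ) * μ with hh₀
  have hh₀q : (1 + τ) * q ≤ h₀ := mul_le_mul_of_nonneg_left hμq (by linarith)
  have hh₀40 : 40 ≤ h₀ := by nlinarith
  -- With this cap 4(h₀ - C) ≥ h₀. Rounding costs at most 1 ≤ 0.025 h₀, because h₀ ≥ 40.
  set C := ⌊0.75 * h₀⌋₊ with hC
  have hC1 : (C : ℝ) ≤ 0.75 * h₀ := Nat.floor_le (by positivity)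
  have hC2 : 0.725 * h₀ ≤ C := by
    have := Nat.sub_one_lt_floor (0.75 * h₀)
    rw [← hC] at this
    linarith
  have hC0 : (0 : ℝ) < C := lt_of_lt_of_le (by positivity) hC2
  -- Chosen so that ε · 0.725 h₀ = 5, which makes the failure probability of Q at most 1/5.
  set ε := 200 / (29 * h₀) with hε
  have hε0 : 0 < ε := by positivity
  have hε1 : ε < 1 := by rw [hε, div_lt_one (by positivity)]; linarith
  have hεh : ε * h₀ = 200 / 29 := by rw [hε]; field_simp
  have hmarkov : h₀ / (4 * (h₀ - C) * (ε * C)) ≤ 1 / 5 := by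
    have h1 : 0.25 * h₀ ≤ h₀ - C := by linarith
    have h2 : ε * (0.725 * h₀) ≤ ε * C := mul_le_mul_of_nonneg_left hC2 hε0.le
    have h3 : 5 ≤ ε * C := by linarith
    have h4 : 0 < 4 * (h₀ - C) * (ε * C) :=
      mul_pos (mul_pos (by norm_num) (by linarith)) (by linarith)
    rw [div_le_div_iff₀ h4 (by norm_num)]
    have h5 : 4 * (0.25 * h₀) * 5 ≤ 4 * (h₀ - C) * (ε * C) :=
      mul_le_mul (by linarith) h3 (by norm_num) (by linarith)
    linarith
  -- Passing from surjective to all maps costs the factor 0.99, and the random Q costs 4/5; 0.99 ·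
  -- 4/5 ≥ 0.79.
  have key := lower_bound_of_large_fibers (δ := 0.99 * δ) (δ' := 0.79 * δ) S C j
    (by exact_mod_cast hC0) (by linarith : (C : ℝ) < h₀) hε0 hε1 Bad ?_ ?_ ?_ (by linarith)
    (by linarith) hρ
  · refine kakeya_parameters_contradiction hδ hδ' hp0 hτp hq20 hap hρ
      (by exact_mod_cast (by omega : t + 2 ≤ n)) hμq hC2 hεh hε0 hε1
      (by rw [hτp]; exact hj) (Nat.cast_nonneg j)
      (key.trans (le_of_eq ?_))
    rw [hμ, Nat.cast_mul, ← hq]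
    field_simp
  · intro L hL
    obtain ⟨-, y, hy⟩ := (Finset.mem_filter.1 hL).2
    refine ⟨y, le_trans (le_of_eq ?_) hy.le⟩
    rw [hh₀, hμ, ← hq, pow_add]
    field_simp
  · calc 0.99 * δ * (Fintype.card ((Fin n → F) →ₗ[F] (Fin t → F)) : ℝ)
        = δ * (0.99 * (Fintype.card ((Fin n → F) →ₗ[F] (Fin t → F)) : ℝ)) := by ring
      _ ≤ δ * (Finset.univ.filter fun L : (Fin n → F) →ₗ[F] (Fin t → F) =>
          Function.Surjective L).card := mul_le_mul_of_nonneg_left hsurj hδ.le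
      _ ≤ _ := hcon.le
  · have h1 : 4 / 5 ≤ 1 - h₀ / (4 * (h₀ - C) * (ε * C)) := by linarith
    have h2 := mul_le_mul_of_nonneg_left h1 (by positivity : 0 ≤ 0.99 * δ)
    linarith

/-! ### From fibre sizes to distributions -/

theorem toReal_imageOfUniform {α β : Type*} [DecidableEq β] (L : α → β) (S : Finset α)
    (hS : S.Nonempty) (y : β) :
    (imageOfUniform L S hS y).toReal = (fiberCount S L y : ℝ) / S.card := by
  classical
  have h : imageOfUniform L S hS y = ∑ x ∈ S, if y = L x then ((S.card : ENNReal))⁻¹ else 0 := by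
    rw [imageOfUniform, PMF.map_apply, tsum_eq_sum (s := S)]
    · refine Finset.sum_congr rfl fun x hx => ?_
      rw [PMF.uniformOfFinset_apply_of_mem hS hx]
      congr
    · intro x hx
      rw [PMF.uniformOfFinset_apply_of_notMem hS hx, ite_self]
  rw [h, ← Finset.sum_filter, Finset.sum_const, nsmul_eq_mul, ENNReal.toReal_mul,
    ENNReal.toReal_inv, ENNReal.toReal_natCast, ENNReal.toReal_natCast, fiberCount,
    div_eq_mul_inv]
  simp only [eq_comm]

theorem mainTheorem5 {F : Type*} [Field F] [Fintype F]
    (n : ℕ) (hn : 20 ≤ n)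
    (S : Finset (Fin n → F)) (hS : S.Nonempty)
    (τ δ : ℝ) (hτ : 1 < τ) (hδ_pos : 0 < δ) (hδ_lt : δ < 1 / 10)
    (hq : max ((n : ℝ) * ((1 + τ) / ((τ - Real.sqrt τ) ^ 2 * δ ^ 2))) (n : ℝ)
      ≤ (Fintype.card F : ℝ))
    (r : ℕ) (hr_lower : 4 ≤ r) (hr_upper : r ≤ n - 1)
    (hS_lower : Fintype.card F ^ r < S.card)
    (hS_upper : S.card ≤ Fintype.card F ^ (r + 1))
    (t : ℕ) (ht : t = r - 3) :
    AtLeastFraction (1 - δ) (surjLinearMaps F n t)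
      (fun L => LInftyClose (imageOfUniform L S hS)
        (PMF.uniformOfFintype (Fin t → F)) (τ / (Fintype.card F : ℝ) ^ t)) := by
  classical
  have hfin : Finite ((Fin n → F) →ₗ[F] (Fin t → F)) := DFunLike.finite _
  let _ : Fintype ((Fin n → F) →ₗ[F] (Fin t → F)) := Fintype.ofFinite _
  have hr : r = t + 3 := by omega
  have hbad := card_large_fibers_le (t := t) hn (by omega) S hτ hδ_pos hδ_lt
    ((le_max_left _ _).trans hq) ((le_max_right _ _).trans hq) (by rw [← hr]; exact hS_lower)
  set Surj := Finset.univ.filter fun L : (Fin n → F) →ₗ[F] (Fin t → F) => Function.Surjective L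
    with hSurj
  set Bad := Finset.univ.filter fun L : (Fin n → F) →ₗ[F] (Fin t → F) => Function.Surjective L ∧
    ∃ y, (1 + τ) * S.card / (Fintype.card F : ℝ) ^ t < fiberCount S L y with hBad
  have hq0 : (0 : ℝ) < (Fintype.card F : ℝ) ^ t := by
    have : (0 : ℝ) < Fintype.card F := by exact_mod_cast Fintype.card_pos
    positivity
  have hS0 : (0 : ℝ) < S.card := by exact_mod_cast hS.card_pos
  have hA : surjLinearMaps F n t = (Surj : Set _) := by
    ext L; simp [surjLinearMaps, hSurj]
  have hsub : ((Surj \ Bad : Finset _) : Set ((Fin n → F) →ₗ[F] (Fin t → F))) ⊆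
      {L ∈ surjLinearMaps F n t | LInftyClose (imageOfUniform L S hS)
        (PMF.uniformOfFintype (Fin t → F)) (τ / (Fintype.card F : ℝ) ^ t)} := by
    intro L hL
    obtain ⟨hL1, hL2⟩ := Finset.mem_sdiff.1 (Finset.mem_coe.1 hL)
    have hLs : Function.Surjective L := (Finset.mem_filter.1 hL1).2
    refine ⟨hLs, fun y => ?_⟩
    have hy : (fiberCount S L y : ℝ) ≤ (1 + τ) * S.card / (Fintype.card F : ℝ) ^ t := by
      by_contra h
      exact hL2 (Finset.mem_filter.2 ⟨Finset.mem_univ _, hLs, y, not_le.1 h⟩)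
    rw [toReal_imageOfUniform, PMF.uniformOfFintype_apply, ENNReal.toReal_inv,
      ENNReal.toReal_natCast, Fintype.card_fun, Fintype.card_fin, Nat.cast_pow]
    have h1 : (fiberCount S L y : ℝ) / S.card ≤ (1 + τ) / (Fintype.card F : ℝ) ^ t := by
      rw [div_le_iff₀ hS0, div_mul_eq_mul_div]; exact hy
    have h2 : (0 : ℝ) ≤ (fiberCount S L y : ℝ) / S.card :=
      div_nonneg (Nat.cast_nonneg _) (Nat.cast_nonneg _)
    have h3 : (1 + τ) / (Fintype.card F : ℝ) ^ t =
        ((Fintype.card F : ℝ) ^ t)⁻¹ + τ / (Fintype.card F : ℝ) ^ t := by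
      rw [add_div, one_div]
    -- The lower deviation is at most q^(-t), which τ > 1 absorbs; no lower bound on fibres is
    -- needed.
    have h4 : ((Fintype.card F : ℝ) ^ t)⁻¹ ≤ τ / (Fintype.card F : ℝ) ^ t := by
      rw [← one_div]; gcongr
    rw [abs_le]
    constructor <;> linarith
  have hcard := Set.ncard_le_ncard hsub (Set.toFinite _)
  rw [Set.ncard_coe_finset] at hcard
  rw [AtLeastFraction]
  refine le_trans ?_ (Nat.cast_le.2 hcard)
  have hBS : Bad ⊆ Surj := fun L hL =>
    Finset.mem_filter.2 ⟨Finset.mem_univ _, (Finset.mem_filter.1 hL).2.1⟩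
  rw [hA, Set.ncard_coe_finset, Finset.cast_card_sdiff hBS]
  linarith
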